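/- Let $\Sigma$ be a finite nonempty set, $n\ge 1$, and for a distribution $\mathcal D$ on $\Sigma^n$ and a query string $\rho\in(\Sigma\cup\{*\})^n$ let $S_\rho$ be the set of all $w\in\Sigma^n$ with $w[i]=\rho[i]$ whenever $\rho[i]\neq *$. A SUBCOND oracle for $\mathcal D$ answers a query $\rho$ by an independent sample from $\mathcal D$ conditioned on $S_\rho$ (its answers are drawn from an arbitrary fixed distribution if $\mathcal D(S_\rho)=0$). Write $d_{TV}(\mathcal P,\mathcal Q)=\frac12\sum_{\sigma}|\mathcal P(\sigma)-\mathcal Q(\sigma)|$, and let $\mathcal D^j_{\sigma_{<j}}$ be the law of $w[j]$ when $w$ is the answer of the oracle for $\mathcal D$ to the query $\sigma[1]\cdots\sigma[j-1]*\cdots*$. Given SUBCOND access to $\mathcal P,\mathcal Q$ on $\Sigma^n$ and $0\le\varepsilon_1<\varepsilon_2\le 1$, the algorithm $\mathsf{SubVsSub}(\mathcal P,\mathcal Q,\varepsilon_1,\varepsilon_2)$ on the hypergrid is as follows. Put $\gamma=(\varepsilon_2-\varepsilon_1)/2$, $m=\lceil 2^4\ln(20)/\gamma^{2}\rceil$,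 $t=\lceil 48\ln(10m)\rceil$, $$M_{grid}=10\left(\frac{2^{10}n^3mt}{\gamma^3}+\frac{2^9n^2mt}{\gamma^2}\right)|\Sigma| ,\qquad \theta=\frac{\gamma}{2|\Sigma|n}.$$ Let $\mathcal P'$ be the $\theta$-tamed version of $\mathcal P$, with $\mathcal P'^{\,j}_{\sigma_{<j}}(c)=(1-|\Sigma|\theta)\,\mathcal P^{j}_{\sigma_{<j}}(c)+\theta$; a call to $\mathcal P'^{\,j}_{\sigma_{<j}}$ returns a uniform letter with probability $|\Sigma|\theta$ and otherwise queries the oracle for $\mathcal P$. For $\mathcal D\in\{\mathcal P',\mathcal Q\}$, $\mathsf{SubToEval}(\mathcal D,\varepsilon,\sigma)$ puts $k=\lceil 4n/\varepsilon^2\rceil$, for each $j=1,\dots,n$ samples from $\mathcal D^j_{\sigma_{<j}}$ until $\sigma[j]$ has been seen $k$ times, with $x_j$ the number of samples taken, and returns $\prod_{j=1}^n k/x_j$. Then $\mathsf{SubVsSub}$ performs $m$ rounds: in round $i$ it draws $\sigma_i\sim\mathcal Q$, lets $p_i$ and $q_i$ be the medians of $t$ independent runs of $\mathsf{SubToEval}(\mathcal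 P',\gamma/8,\sigma_i)$ and of $\mathsf{SubToEval}(\mathcal Q,\gamma/8,\sigma_i)$, and sets $\Gamma_i=1-p_i/q_i$ if $q_i>p_i$ and $\Gamma_i=0$ otherwise. It returns Accept if $\frac1m\sum_i\Gamma_i\le(\varepsilon_1+\varepsilon_2)/2$ and Reject otherwise; it stops and returns Reject as soon as it would need more than $M_{grid}$ calls to its samplers (calls to $\mathcal P'$ or $\mathcal Q$) in total. **Theorem.** $\mathsf{SubVsSub}(\mathcal P,\mathcal Q,\varepsilon_1,\varepsilon_2)$ makes at most $\tilde O\!\left(n^3|\Sigma|/(\varepsilon_2-\varepsilon_1)^5\right)$ SUBCOND queries on every run; that is, there are absolute constants $C,a$ such that the number of queries is at most $C\,X\,(1+\ln X)^a$ with $X=n^3|\Sigma|/(\varepsilon_2-\varepsilon_1)^5$, for all $\Sigma,n,\varepsilon_1,\varepsilon_2,\mathcal P,\mathcal Q$. Moreover, with probability at least $3/5$ it returns Accept if $d_{TV}(\mathcal P,\mathcal Q)<\varepsilon_1$, and with probability at least $3/5$ it returns Reject if $d_{TV}(\mathcal P,\mathcal Q)>\varepsilon_2$. -/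

import Mathlib

open scoped ENNReal

namespace HypergridTest

universe u v w

noncomputable section

/-! ### Distributions on the hypergrid and subcube conditioning -/

/-- Total variation distance of two distributions on a finite set:
half the `ℓ₁` distance of the probability mass functions. -/
def tvDist {Ω : Type u} [Fintype Ω] (D₁ D₂ : PMF Ω) : ℝ :=
  (1 / 2) * ∑ x, |(D₁ x).toReal - (D₂ x).toReal|

/-- A query string in `(S ∪ {*})ⁿ`; `none` plays the role of `*`. -/
abbrev QueryString (S : Type u) (n : ℕ) : Type u := Fin n → Option S

/-- The strings that match all the non-`*` characters of `ρ`. -/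
def subcube {S : Type u} {n : ℕ} (ρ : QueryString S n) : Set (Fin n → S) :=
  {x | ∀ i, ∀ c, ρ i = some c → x i = c}

/-- `O` is a subcube conditioning oracle for `D`: on a query string `ρ` whose subcube has positive
mass, it samples from `D` conditioned on the subcube of `ρ`.  On query strings whose subcube has
mass zero, where the conditional distribution is undefined, nothing is required. -/
def IsSubcondOracle {S : Type u} {n : ℕ} (D : PMF (Fin n → S))
    (O : QueryString S n → PMF (Fin n → S)) : Prop :=
  ∀ (ρ : QueryString S n) (h : ∃ x ∈ subcube ρ, x ∈ D.support), O ρ = D.filter (subcube ρ) h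

/-! ### Randomized algorithms with access to two subcube conditioning oracles -/

/-- The two oracles an algorithm may call. -/
inductive Source : Type
  | P
  | Q

/-- The output of a closeness tester. -/
inductive Verdict : Type
  | accept
  | reject

/-- Randomized algorithms with subcube conditioning access to two unknown distributions on `Sⁿ`,
returning a value in `α`.  The algorithm may stop, toss a coin that shows `true` with a known
probability `p`, draw a uniform letter of `S`, or call one of the two oracles with a query string;
it continues according to the outcome. -/
inductive Prog (S : Type u) (n : ℕ) (α : Type v) : Type (max u v)
  | done (a : α) : Prog S n α
  | coin (p : unitInterval) (k : Bool → Prog S n α) : Prog S n α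
  | letter (k : S → Prog S n α) : Prog S n α
  | query (s : Source) (ρ : QueryString S n) (k : (Fin n → S) → Prog S n α) : Prog S n α

/-- The distribution on `Bool` that gives `true` the probability `p`. -/
def coinPMF (p : unitInterval) : PMF Bool :=
  PMF.ofFintype (fun b => if b then ENNReal.ofReal p else ENNReal.ofReal (1 - p)) (by
    have h0 : (0 : ℝ) ≤ p := p.2.1
    have h1 : (0 : ℝ) ≤ 1 - p := sub_nonneg.2 p.2.2
    simp [← ENNReal.ofReal_add h0 h1])

namespace Prog

variable {S : Type u} {n : ℕ} {α : Type v} {β : Type w}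

/-- Sequential composition. -/
def bind : Prog S n α → (α → Prog S n β) → Prog S n β
  | done a, f => f a
  | coin p k, f => coin p fun b => (k b).bind f
  | letter k, f => letter fun c => (k c).bind f
  | query s ρ k, f => query s ρ fun x => (k x).bind f

/-- The distribution of the output, when the oracles are `OP` and `OQ` and all oracle answers and
internal random choices are drawn independently. -/
def eval [Fintype S] [Nonempty S] (OP OQ : QueryString S n → PMF (Fin n → S)) :
    Prog S n α → PMF α
  | done a => PMF.pure a
  | coin p k => (coinPMF p).bind fun b => (k b).eval OP OQ
  | letter k => (PMF.uniformOfFintype S).bind fun c => (k c).eval OP OQ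
  | query .P ρ k => (OP ρ).bind fun x => (k x).eval OP OQ
  | query .Q ρ k => (OQ ρ).bind fun x => (k x).eval OP OQ

/-- On every run, whatever the oracle answers and the internal random choices, the algorithm makes
at most the given number of oracle queries (to the two oracles together). -/
def QueriesAtMost : Prog S n α → ℕ → Prop
  | done _, _ => True
  | coin _ k, q => ∀ b, (k b).QueriesAtMost q
  | letter k, q => ∀ c, (k c).QueriesAtMost q
  | query _ _ _, 0 => False
  | query _ _ k, q + 1 => ∀ x, (k x).QueriesAtMost q

end Prog

/-! ### Algorithms with a budget of oracle calls -/

/-- An algorithm that is given a budget of oracle calls and returns either a value with the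
remaining budget, or `none` if it would have to exceed the budget. -/
def Metered (S : Type u) (n : ℕ) (α : Type v) : Type (max u v) :=
  ℕ → Prog S n (Option (α × ℕ))

namespace Metered

variable {S : Type u} {n : ℕ} {α : Type v} {β : Type w}

/-- Return a value without touching the budget. -/
def pure (a : α) : Metered S n α := fun b => .done (some (a, b))

/-- Sequential composition; an exceeded budget ends the computation. -/
def bind (x : Metered S n α) (f : α → Metered S n β) : Metered S n β := fun b =>
  (x b).bind fun r =>
    match r with
    | none => .done none
    | some (a, b') => f a b'

/-- Make one call, at the cost of one unit of the budget. -/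
def call (ask : Prog S n α) : Metered S n α
  | 0 => .done none
  | b + 1 => ask.bind fun a => .done (some (a, b))

/-- Run `f` on the members of a list one after the other, and collect the results. -/
def forEach {ι : Type w} (f : ι → Metered S n α) : List ι → Metered S n (List α)
  | [] => pure []
  | i :: l => (f i).bind fun a => (forEach f l).bind fun as => pure (a :: as)

end Metered

/-! ### The tester -/

section Tester

variable {S : Type u} {n : ℕ}

/-- The query string `σ[1] ⋯ σ[j-1] * ⋯ *`. -/
def prefixQuery (σ : Fin n → S) (j : Fin n) : QueryString S n :=
  fun i => if i < j then some (σ i) else none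

/-- One sample from the marginal in coordinate `j` of the distribution behind `s`, conditioned
on the prefix `σ[1] ⋯ σ[j-1]`. -/
def askMarginal (s : Source) (σ : Fin n → S) (j : Fin n) : Prog S n S :=
  .query s (prefixQuery σ j) fun x => .done (x j)

/-- One sample from the conditional marginal of the `θ`-tamed version `P'` of `P`, in which a
letter `c` has probability `(1 - |S| θ) p(c) + θ` where it had probability `p(c)` in `P`:
with probability `|S| θ` a uniform letter, else a sample from the conditional marginal of `P`. -/
def askTamed [Fintype S] (θ : ℝ) (σ : Fin n → S) (j : Fin n) : Prog S n S :=
  .coin (Set.projIcc 0 1 zero_le_one (Fintype.card S * θ)) fun b =>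
    if b then .letter fun c => .done c else askMarginal .P σ j

/-- Call `ask` until the letter `c` has been seen `r` more times, where `x` calls were made before;
return the total number of calls.  The first argument after `c` is the budget. -/
def waitFor [DecidableEq S] (ask : Prog S n S) (c : S) :
    ℕ → ℕ → ℕ → Prog S n (Option (ℕ × ℕ))
  | b, 0, x => .done (some (x, b))
  | 0, _ + 1, _ => .done none
  | b + 1, r + 1, x => ask.bind fun a =>
      if a = c then waitFor ask c b r (x + 1) else waitFor ask c b (r + 1) (x + 1)

/-- The subroutine `SubToEval` for estimating the probability of `σ` up to a factor `1 ± ε`, in the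
distribution whose conditional marginals are sampled by `ask`. -/
def subToEval [DecidableEq S] (ask : (Fin n → S) → Fin n → Prog S n S) (ε : ℝ) (σ : Fin n → S) :
    Metered S n ℝ :=
  let k : ℕ := ⌈4 * (n : ℝ) / ε ^ 2⌉₊
  (Metered.forEach (fun j : Fin n => fun b => waitFor (ask σ j) (σ j) b k 0)
    (List.finRange n)).bind fun xs => Metered.pure (xs.map fun x : ℕ => (k : ℝ) / x).prod

/-- The median of a list of reals: the middle entry of the sorted list, or the mean of the two
middle entries. -/
def median (l : List ℝ) : ℝ :=
  let s := l.insertionSort (· ≤ ·)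
  (s.getD ((l.length - 1) / 2) 0 + s.getD (l.length / 2) 0) / 2

/-- The gap parameter `γ`. -/
def gap (ε₁ ε₂ : ℝ) : ℝ := (ε₂ - ε₁) / 2

/-- The number `m` of samples from `Q`. -/
def numSamples (γ : ℝ) : ℕ := ⌈2 ^ 4 * Real.log 20 / γ ^ 2⌉₊

/-- The number `t` of repetitions of `SubToEval` whose median is taken. -/
def numReps (γ : ℝ) : ℕ := ⌈48 * Real.log (10 * numSamples γ)⌉₊

/-- The budget `M_grid = |S| · M` of oracle calls, where `M` is the budget on the hypercube. -/
def gridBudget (card n : ℕ) (γ : ℝ) : ℝ :=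
  10 * (2 ^ 10 * (n : ℝ) ^ 3 * numSamples γ * numReps γ / γ ^ 3
    + 2 ^ 9 * (n : ℝ) ^ 2 * numSamples γ * numReps γ / γ ^ 2) * card

/-- One round of the tester: draw `σ` from `Q`, estimate `P'(σ)` and `Q(σ)` by `p` and `q`, and
return `1 - p / q` if `q > p`, and `0` otherwise. -/
def testRound [Fintype S] [DecidableEq S] (γ : ℝ) : Metered S n ℝ :=
  (Metered.call (.query .Q (fun _ => none) fun σ => .done σ)).bind fun σ =>
  (Metered.forEach (fun _ : ℕ =>
      (subToEval (askTamed (γ / (2 * Fintype.card S * n))) (γ / 8) σ).bind fun p =>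
      (subToEval (askMarginal .Q) (γ / 8) σ).bind fun q =>
      Metered.pure (p, q)) (List.range (numReps γ))).bind fun pqs =>
  let p := median (pqs.map Prod.fst)
  let q := median (pqs.map Prod.snd)
  Metered.pure (if p < q then 1 - p / q else 0)

variable (S n) in
/-- The tester `SubVsSub` for distributions on the hypergrid `Sⁿ`.  It rejects if it would need
more oracle calls than its budget allows. -/
def subVsSub [Fintype S] [DecidableEq S] (ε₁ ε₂ : ℝ) : Prog S n Verdict :=
  let γ := gap ε₁ ε₂
  (Metered.forEach (fun _ : ℕ => testRound γ) (List.range (numSamples γ))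
      ⌊gridBudget (Fintype.card S) n γ⌋₊).bind fun r =>
    match r with
    | none => .done .reject
    | some (Γ, _) =>
      if Γ.sum / numSamples γ ≤ (ε₁ + ε₂) / 2 then .done .accept else .done .reject

end Tester

end

end HypergridTest

/-! The tester estimates the mean over `σ ∼ Q` of `max 0 (1 - P'(σ)/Q(σ))`. For `P' = P` this mean
is `d_TV(P, Q)`. Taming keeps `P' ≥ (1 - γ/2) P` and total mass at most `1`, so it shifts the mean
by at most `γ/2`, while every conditional letter probability of `P'` is at least `θ`.

Waiting for `k` hits of a letter of probability `p` takes a number `x` of calls with mean `k/p` and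
variance `k(1-p)/p²`. Hence the ratio (true probability)/(estimate) returned by `SubToEval` has mean
`1` and second moment at most `(1 + 1/k)^n`, and Chebyshev gives a factor `1 ± γ/8` except with
probability `1/3`. Medians reduce the failure probability to `(17/18)^t` (`lossBound_round`), and
Chebyshev for the `m` bounded statistics controls their average (`tail_le`).

The expected number of calls for one string is at most `n k/θ` per run for `P'`. For `Q` it is `∑ j,
k/q_j(σ)`, and its mean over `σ ∼ Q` is at most `k n |S|`: dividing `Q(σ)` by its `j`-th factor
leaves weights of total mass at most `|S|`. The expected total is at most a tenth of the budget.

Waiting may be endless without the budget, so cost and failure are bounded jointly and always for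
the budgeted program. Each call costs `h`, the forbidden one included, and the output costs `F`;
bounds on the expected loss compose like potentials (`LossBound.bind`). With `h = 1/(b+1)`, running
out of a budget `b` costs exactly `1`, which is Markov's inequality. The total failure probability
is at most `1/10 + 1/50 + 11/100 < 2/5` (`expect_badOutcome_le`). -/

namespace HypergridTest

universe u v w

/-! ### Expectations of outputs -/

namespace Prog

variable {S : Type u} {n : ℕ} {α : Type v} {β : Type w} [Fintype S]

/-- The expectation of a real function of the output.  All random choices of a program range over
finite sets, so this is a finite sum. -/
noncomputable def expect (OP OQ : QueryString S n → PMF (Fin n → S)) :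
    Prog S n α → (α → ℝ) → ℝ
  | done a, F => F a
  | coin p k, F => p * (k true).expect OP OQ F + (1 - p) * (k false).expect OP OQ F
  | letter k, F => ∑ c, (Fintype.card S : ℝ)⁻¹ * (k c).expect OP OQ F
  | query .P ρ k, F => ∑ x, (OP ρ x).toReal * (k x).expect OP OQ F
  | query .Q ρ k, F => ∑ x, (OQ ρ x).toReal * (k x).expect OP OQ F

variable {OP OQ : QueryString S n → PMF (Fin n → S)}

theorem expect_mono {F G : α → ℝ} (h : ∀ a, F a ≤ G a) (p : Prog S n α) :
    p.expect OP OQ F ≤ p.expect OP OQ G := by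
  induction p with
  | done a => exact h a
  | coin p k ih =>
    have h0 : (0 : ℝ) ≤ p := p.2.1
    have h1 : (0 : ℝ) ≤ 1 - p := sub_nonneg.2 p.2.2
    exact add_le_add (mul_le_mul_of_nonneg_left (ih _) h0) (mul_le_mul_of_nonneg_left (ih _) h1)
  | letter k ih =>
    exact Finset.sum_le_sum fun c _ => mul_le_mul_of_nonneg_left (ih c) (by positivity)
  | query s ρ k ih =>
    cases s <;>
    exact Finset.sum_le_sum fun c _ => mul_le_mul_of_nonneg_left (ih c) (by positivity)

theorem expect_bind (p : Prog S n α) (f : α → Prog S n β) (F : β → ℝ) :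
    (p.bind f).expect OP OQ F = p.expect OP OQ fun a => (f a).expect OP OQ F := by
  induction p with
  | done a => rfl
  | coin p k ih => simp [bind, expect, ih]
  | letter k ih => simp [bind, expect, ih]
  | query s ρ k ih => cases s <;> simp [bind, expect, ih]

theorem sum_toReal_eq_one {Ω : Type*} [Fintype Ω] (D : PMF Ω) : ∑ x, (D x).toReal = 1 := by
  have h := D.tsum_coe
  rw [tsum_fintype] at h
  rw [← ENNReal.toReal_sum fun x _ => D.apply_ne_top x, h, ENNReal.toReal_one]

theorem expect_const_add [Nonempty S] (p : Prog S n α) (c : ℝ) (F : α → ℝ) :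
    p.expect OP OQ (fun a => c + F a) = c + p.expect OP OQ F := by
  induction p with
  | done a => rfl
  | coin p k ih => simp only [expect, ih]; ring
  | letter k ih =>
    simp only [expect, ih, mul_add, Finset.sum_add_distrib, Finset.sum_const, Finset.card_univ,
      nsmul_eq_mul]
    rw [← mul_assoc, mul_inv_cancel₀ (by simp), one_mul]
  | query s ρ k ih =>
    cases s <;>
    simp only [expect, ih, mul_add, Finset.sum_add_distrib, ← Finset.sum_mul, sum_toReal_eq_one,
      one_mul]

theorem expect_const_sub [Nonempty S] (p : Prog S n α) (c : ℝ) (F : α → ℝ) :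
    p.expect OP OQ (fun a => c - F a) = c - p.expect OP OQ F := by
  induction p with
  | done a => rfl
  | coin p k ih => simp only [expect, ih]; ring
  | letter k ih =>
    simp only [expect, ih, mul_sub, Finset.sum_sub_distrib, Finset.sum_const, Finset.card_univ,
      nsmul_eq_mul]
    rw [← mul_assoc, mul_inv_cancel₀ (by simp), one_mul]
  | query s ρ k ih =>
    cases s <;>
    simp only [expect, ih, mul_sub, Finset.sum_sub_distrib, ← Finset.sum_mul, sum_toReal_eq_one,
      one_mul]

theorem expect_nonneg {F : α → ℝ} (h : ∀ a, 0 ≤ F a) (p : Prog S n α) :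
    0 ≤ p.expect OP OQ F := by
  induction p with
  | done a => exact h a
  | coin p k ih =>
    have h0 : (0 : ℝ) ≤ p := p.2.1
    have h1 : (0 : ℝ) ≤ 1 - p := sub_nonneg.2 p.2.2
    exact add_nonneg (mul_nonneg h0 (ih _)) (mul_nonneg h1 (ih _))
  | letter k ih => exact Finset.sum_nonneg fun c _ => mul_nonneg (by positivity) (ih c)
  | query s ρ k ih =>
    cases s <;> exact Finset.sum_nonneg fun c _ => mul_nonneg (by positivity) (ih c)

theorem ofReal_sum_toReal_mul {Ω : Type*} [Fintype Ω] (D : PMF Ω) (f : Ω → ℝ)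
    (hf : ∀ x, 0 ≤ f x) :
    ENNReal.ofReal (∑ x, (D x).toReal * f x) = ∑ x, D x * ENNReal.ofReal (f x) := by
  rw [ENNReal.ofReal_sum_of_nonneg fun x _ => mul_nonneg (by positivity) (hf x)]
  refine Finset.sum_congr rfl fun x _ => ?_
  rw [ENNReal.ofReal_mul (by positivity), ENNReal.ofReal_toReal (D.apply_ne_top x)]

theorem eval_apply [Nonempty S] [DecidableEq α] (p : Prog S n α) (v : α) :
    p.eval OP OQ v = ENNReal.ofReal (p.expect OP OQ fun a => if a = v then 1 else 0) := by
  have hF : ∀ a : α, (0 : ℝ) ≤ if a = v then 1 else 0 := fun a => by split <;> simp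
  induction p with
  | done a =>
    by_cases h : a = v
    · simp [eval, expect, h]
    · simp [eval, expect, h, PMF.pure_apply, Ne.symm h]
  | coin p k ih =>
    have h0 : (0 : ℝ) ≤ p := p.2.1
    have h1 : (0 : ℝ) ≤ 1 - p := sub_nonneg.2 p.2.2
    simp only [eval, expect, PMF.bind_apply, tsum_fintype, Fintype.sum_bool, ih]
    rw [ENNReal.ofReal_add (mul_nonneg h0 (expect_nonneg hF _))
      (mul_nonneg h1 (expect_nonneg hF _)), ENNReal.ofReal_mul h0, ENNReal.ofReal_mul h1]
    simp [coinPMF]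
  | letter k ih =>
    simp only [eval, expect, PMF.bind_apply, tsum_fintype, ih]
    rw [ENNReal.ofReal_sum_of_nonneg
      fun x _ => mul_nonneg (by positivity) (expect_nonneg hF _)]
    refine Finset.sum_congr rfl fun x _ => ?_
    rw [ENNReal.ofReal_mul (by positivity), PMF.uniformOfFintype_apply,
      ENNReal.ofReal_inv_of_pos (by positivity), ENNReal.ofReal_natCast]
  | query s ρ k ih =>
    cases s <;>
    simp only [eval, expect, PMF.bind_apply, tsum_fintype, ih] <;>
    rw [ofReal_sum_toReal_mul _ _ fun x => expect_nonneg hF _]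

end Prog

/-! ### Expected cost of metered algorithms -/

namespace Metered

variable {S : Type u} {n : ℕ} {α : Type v} {β : Type w}

/-- The loss of an outcome of a metered algorithm with budget `b`: every call costs `h`, the call
that would exceed the budget included, and a returned value `a` costs `F a`. -/
def loss (h : ℝ) (b : ℕ) (F : α → ℝ) : Option (α × ℕ) → ℝ
  | none => (b + 1) * h
  | some (a, b') => (b - b') * h + F a

variable [Fintype S]

/-- With any budget, the expected loss is at most `V`. -/
def LossBound (OP OQ : QueryString S n → PMF (Fin n → S)) (h : ℝ) (x : Metered S n α)
    (F : α → ℝ) (V : ℝ) : Prop :=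
  ∀ b, (x b).expect OP OQ (loss h b F) ≤ V

variable {OP OQ : QueryString S n → PMF (Fin n → S)} {h : ℝ}

theorem LossBound.pure {a : α} {F : α → ℝ} {V : ℝ} (hV : F a ≤ V) :
    LossBound OP OQ h (Metered.pure a) F V := fun b => by
  simpa [Metered.pure, Prog.expect, loss] using hV

theorem LossBound.mono {x : Metered S n α} {F G : α → ℝ} {V V' : ℝ}
    (hx : LossBound OP OQ h x G V) (hFG : ∀ a, F a ≤ G a) (hV : V ≤ V') :
    LossBound OP OQ h x F V' := fun b => by
  refine (Prog.expect_mono (fun r => ?_) _).trans ((hx b).trans hV)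
  rcases r with _ | ⟨a, b'⟩
  · exact le_rfl
  · exact add_le_add le_rfl (hFG a)

/-- Here `G` is the value of continuing from the intermediate result. The loss is additive in the
budget spent, so the uniformity of the bounds in the budget lets the second stage start from
whatever remains. -/
theorem LossBound.bind [Nonempty S] {x : Metered S n α} {f : α → Metered S n β} {F : β → ℝ}
    {G : α → ℝ} {V : ℝ} (hx : LossBound OP OQ h x G V)
    (hf : ∀ a, LossBound OP OQ h (f a) F (G a)) :
    LossBound OP OQ h (x.bind f) F V := fun b => by
  rw [Metered.bind, Prog.expect_bind]
  refine (Prog.expect_mono (fun r => ?_) _).trans (hx b)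
  rcases r with _ | ⟨a, b'⟩
  · exact le_rfl
  · have hl : loss h b F = fun r => ((b : ℝ) - b') * h + loss h b' F r := by
      funext r
      rcases r with _ | ⟨a, b''⟩ <;> simp only [loss] <;> ring
    change (f a b').expect OP OQ (loss h b F) ≤ (b - b') * h + G a
    rw [hl, Prog.expect_const_add]
    exact add_le_add le_rfl (hf a b')

theorem LossBound.forEach_cons [Nonempty S] {ι : Type w} {f : ι → Metered S n α} {i : ι}
    {l : List ι} {F : List α → ℝ} {G : α → ℝ} {V : ℝ} (hi : LossBound OP OQ h (f i) G V)
    (hl : ∀ a, LossBound OP OQ h (forEach f l) (fun as => F (a :: as)) (G a)) :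
    LossBound OP OQ h (forEach f (i :: l)) F V :=
  hi.bind fun a => (hl a).bind fun _ => .pure le_rfl

/-- Drawing a string from the oracle for `Q` and continuing according to the outcome. -/
theorem LossBound.callQ_bind [Nonempty S] {ρ : QueryString S n}
    {f : (Fin n → S) → Metered S n β} {F : β → ℝ} {G : (Fin n → S) → ℝ} {V : ℝ}
    (hG : ∀ x, 0 ≤ G x) (hf : ∀ x, OQ ρ x ≠ 0 → LossBound OP OQ h (f x) F (G x))
    (hV : h + ∑ x, (OQ ρ x).toReal * G x ≤ V) :
    LossBound OP OQ h ((call (.query .Q ρ fun x => .done x)).bind f) F V := fun b => by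
  refine le_trans ?_ hV
  -- With no budget left the loss is just `h`; this is where the nonnegativity of `G` enters.
  rcases b with _ | b
  · have : 0 ≤ ∑ x, (OQ ρ x).toReal * G x :=
      Finset.sum_nonneg fun x _ => mul_nonneg (by positivity) (hG x)
    simpa [Metered.bind, call, Prog.bind, Prog.expect, loss] using this
  · have hl : loss h (b + 1) F = fun r => h + loss h b F r := by
      funext r
      rcases r with _ | ⟨a, b''⟩ <;> simp only [loss] <;> push_cast <;> ring
    simp only [Metered.bind, call, Prog.bind, Prog.expect]
    rw [hl]
    simp only [Prog.expect_const_add, mul_add, Finset.sum_add_distrib, ← Finset.sum_mul,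
      Prog.sum_toReal_eq_one, one_mul]
    gcongr h + ∑ x, ?_ with x
    by_cases hx : OQ ρ x = 0
    · simp [hx]
    · exact mul_le_mul_of_nonneg_left (hf x hx b) (by positivity)

end Metered

/-! ### Estimating the probability of a string -/

section Estimate

variable {S : Type u} {n : ℕ} [Fintype S] [Nonempty S] [DecidableEq S]
  {OP OQ : QueryString S n → PMF (Fin n → S)} {h : ℝ}

/-- A single call of `ask` returns `c` with probability `p`. -/
def HitsWith (OP OQ : QueryString S n → PMF (Fin n → S)) (ask : Prog S n S) (c : S)
    (p : ℝ) : Prop :=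
  ∀ X Y : ℝ, ask.expect OP OQ (fun a => if a = c then X else Y) = p * X + (1 - p) * Y

/-- The right side is the cost plus the quadratic evaluated with the mean and variance of a negative
binomial waiting time, and it satisfies the one-step recursion exactly. The condition `B² ≤ A C`
makes the quadratic nonnegative, so that stopping for lack of budget, which pays no quadratic,
cannot exceed the bound. -/
theorem expect_waitFor_le {ask : Prog S n S} {c : S} {p : ℝ} (hask : HitsWith OP OQ ask c p)
    (hp : 0 < p) (hp1 : p ≤ 1) (hh : 0 ≤ h) {A B C : ℝ} (hA : 0 ≤ A) (hC : 0 ≤ C)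
    (hAC : B ^ 2 ≤ A * C) (b r x : ℕ) :
    (waitFor ask c b r x).expect OP OQ
        (Metered.loss h b fun y : ℕ => A * (y : ℝ) ^ 2 - 2 * B * y + C) ≤
      h * (r / p) + (A * ((x + r / p) ^ 2 + r * (1 - p) / p ^ 2) - 2 * B * (x + r / p) + C) := by
  have hquad : ∀ z : ℝ, 0 ≤ A * z ^ 2 - 2 * B * z + C := fun z => by
    rcases hA.eq_or_lt with rfl | hA
    · have : B = 0 := by nlinarith [sq_nonneg B]
      simp [this, hC]
    · nlinarith [sq_nonneg (A * z - B), mul_nonneg hA.le hC]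
  induction b generalizing r x with
  | zero =>
    rcases r with _ | r
    · simp [waitFor, Prog.expect, Metered.loss]
    · have h1 : 0 ≤ A * (((r + 1 : ℕ) : ℝ) * (1 - p) / p ^ 2) := by
        have := sub_nonneg.2 hp1
        positivity
      have h2 : h ≤ h * (((r + 1 : ℕ) : ℝ) / p) := by
        refine le_mul_of_one_le_right hh ((one_le_div hp).2 ?_)
        push_cast
        linarith [Nat.cast_nonneg (α := ℝ) r]
      simp only [waitFor, Prog.expect, Metered.loss]
      have := hquad (x + ((r + 1 : ℕ) : ℝ) / p)
      push_cast at *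
      linarith
  | succ b ih =>
    rcases r with _ | r
    · simp [waitFor, Prog.expect, Metered.loss]
    · have hl : ∀ F : ℕ → ℝ, Metered.loss h (b + 1) F = fun r => h + Metered.loss h b F r := by
        intro F
        funext r
        rcases r with _ | ⟨a, b''⟩ <;> simp only [Metered.loss] <;> push_cast <;> ring
      rw [waitFor, Prog.expect_bind, hl]
      have hite : ∀ (a : S) (q q' : Prog S n (Option (ℕ × ℕ))) (F : Option (ℕ × ℕ) → ℝ),
          (if a = c then q else q').expect OP OQ F =
            if a = c then q.expect OP OQ F else q'.expect OP OQ F := fun a q q' F => by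
        split <;> rfl
      simp only [hite]
      rw [hask]
      simp only [Prog.expect_const_add]
      refine (add_le_add (mul_le_mul_of_nonneg_left (add_le_add le_rfl (ih r (x + 1))) hp.le)
        (mul_le_mul_of_nonneg_left (add_le_add le_rfl (ih (r + 1) (x + 1)))
          (sub_nonneg.2 hp1))).trans (le_of_eq ?_)
      push_cast
      field_simp
      ring

theorem lossBound_waitFor {ask : Prog S n S} {c : S} {p : ℝ} (hask : HitsWith OP OQ ask c p)
    (hp : 0 < p) (hp1 : p ≤ 1) (hh : 0 ≤ h) {A B C : ℝ} (hA : 0 ≤ A) (hC : 0 ≤ C)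
    (hAC : B ^ 2 ≤ A * C) {k : ℕ} (hk : 0 < k) :
    Metered.LossBound OP OQ h (fun b => waitFor ask c b k 0)
      (fun x : ℕ => A * (p * (x / k)) ^ 2 - 2 * B * (p * (x / k)) + C)
      (h * (k / p) + (A * (1 + 1 / k) - 2 * B + C)) := fun b => by
  have hk' : (0 : ℝ) < k := by exact_mod_cast hk
  have key := expect_waitFor_le hask hp hp1 hh (A := A * (p / k) ^ 2) (B := B * (p / k)) (C := C)
    (by positivity) hC
    (by nlinarith [mul_le_mul_of_nonneg_left hAC (sq_nonneg (p / k))]) b k 0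
  have e1 : (fun x : ℕ => A * (p * (x / k)) ^ 2 - 2 * B * (p * (x / k)) + C) =
      fun y : ℕ => A * (p / k) ^ 2 * (y : ℝ) ^ 2 - 2 * (B * (p / k)) * y + C := by
    funext x
    ring
  rw [e1]
  refine key.trans (add_le_add le_rfl ?_)
  have e2 : A * (p / k) ^ 2 * ((((0 : ℕ) : ℝ) + k / p) ^ 2 + k * (1 - p) / p ^ 2)
      - 2 * (B * (p / k)) * (((0 : ℕ) : ℝ) + k / p) + C
      = A * (1 + (1 - p) / k) - 2 * B + C := by
    push_cast
    field_simp
    ring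
  rw [e2]
  have : (1 - p) / k ≤ 1 / k := by gcongr; linarith
  nlinarith [mul_le_mul_of_nonneg_left this hA]

/-- Nonnegative quadratics are stable under rescaling of the variable. Fixing the first ratio `p j *
(x / k)` turns the coefficients `A`, `B` for the rest into multiples by its square and itself;
second moments therefore multiply and means stay `1`. -/
theorem lossBound_forEach_waitFor {ι : Type w} {ask : ι → Prog S n S} {c : ι → S} {p : ι → ℝ}
    (hask : ∀ j, HitsWith OP OQ (ask j) (c j) (p j)) (hp : ∀ j, 0 < p j) (hp1 : ∀ j, p j ≤ 1)
    (hh : 0 ≤ h) {k : ℕ} (hk : 0 < k) (l : List ι) {A B C : ℝ} (hA : 0 ≤ A) (hC : 0 ≤ C)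
    (hAC : B ^ 2 ≤ A * C) :
    Metered.LossBound OP OQ h (Metered.forEach (fun j b => waitFor (ask j) (c j) b k 0) l)
      (fun xs => A * ((l.map p).prod * (xs.map fun x : ℕ => (k : ℝ) / x).prod⁻¹) ^ 2
        - 2 * B * ((l.map p).prod * (xs.map fun x : ℕ => (k : ℝ) / x).prod⁻¹) + C)
      (h * (l.map fun j => k / p j).sum + (A * (1 + 1 / k) ^ l.length - 2 * B + C)) := by
  induction l generalizing A B C with
  | nil => exact .pure (by simp)
  | cons j l ih =>
    have hs : 0 ≤ (l.map fun j => (k : ℝ) / p j).sum :=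
      List.sum_nonneg fun x hx => by
        obtain ⟨i, -, rfl⟩ := List.mem_map.1 hx
        have := hp i
        positivity
    have hV : (1 : ℝ) ≤ (1 + 1 / k) ^ l.length := one_le_pow₀ (by simp)
    -- The head is charged the value of the tail: the tail's second-moment factor goes into `A`, its
    -- cost into `C`.
    have hx := lossBound_waitFor (hask j) (hp j) (hp1 j) hh
      (A := A * (1 + 1 / k) ^ l.length) (B := B)
      (C := C + h * (l.map fun j => (k : ℝ) / p j).sum) (by positivity) (by positivity) (by
        calc B ^ 2 ≤ A * C := hAC
          _ ≤ _ := by gcongr ?_ * ?_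
                      · exact le_mul_of_one_le_right hA hV
                      · exact le_add_of_nonneg_right (by positivity)) hk
    refine (Metered.LossBound.forEach_cons hx fun x => ?_).mono (fun _ => le_rfl) (le_of_eq ?_)
    · refine (ih (A := A * (p j * (x / k)) ^ 2) (B := B * (p j * (x / k))) (C := C)
        (by positivity) hC (by
          nlinarith [mul_le_mul_of_nonneg_left hAC (sq_nonneg (p j * ((x : ℝ) / k)))])).mono
        (fun xs => le_of_eq ?_) (le_of_eq ?_)
      · simp only [List.map_cons, List.prod_cons, mul_inv, inv_div]
        ring
      · ring
    · simp only [List.map_cons, List.sum_cons, List.length_cons]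
      ring

/-- With `y = ε²/4 ≥ n/k`, use `(1 + 1/k)^n ≤ e^y ≤ 1 + y + y²`. This is the Chebyshev bound for the
failure of one run. -/
theorem one_add_one_div_pow_sub_one_le {ε : ℝ} (hε : 0 < ε) (hε' : ε ≤ 1 / 16) {n k : ℕ}
    (hk : 0 < k) (hkn : 4 * (n : ℝ) / ε ^ 2 ≤ k) :
    (1 + 1 / ε) ^ 2 * ((1 + 1 / (k : ℝ)) ^ n - 1) ≤ 1 / 3 := by
  have hk' : (0 : ℝ) < k := by exact_mod_cast hk
  have h1 : (n : ℝ) * (1 / k) ≤ ε ^ 2 / 4 := by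
    rw [div_le_iff₀ (by positivity)] at hkn
    rw [mul_one_div, div_le_div_iff₀ hk' (by norm_num)]
    linarith
  have h2 : (1 + 1 / (k : ℝ)) ^ n ≤ Real.exp (ε ^ 2 / 4) := by
    calc (1 + 1 / (k : ℝ)) ^ n ≤ Real.exp (1 / k) ^ n := by
          gcongr
          linarith [Real.add_one_le_exp (1 / (k : ℝ))]
      _ = Real.exp (n * (1 / k)) := (Real.exp_nat_mul _ _).symm
      _ ≤ _ := Real.exp_le_exp.2 h1
  have h3 : Real.exp (ε ^ 2 / 4) - 1 - ε ^ 2 / 4 ≤ (ε ^ 2 / 4) ^ 2 :=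
    (le_abs_self _).trans (Real.abs_exp_sub_one_sub_id_le (by
      rw [abs_of_nonneg (by positivity)]
      nlinarith))
  calc (1 + 1 / ε) ^ 2 * ((1 + 1 / (k : ℝ)) ^ n - 1)
      ≤ (1 + 1 / ε) ^ 2 * (ε ^ 2 / 4 + (ε ^ 2 / 4) ^ 2) := by
        gcongr
        linarith
    _ = (1 + ε) ^ 2 * (1 / 4 + ε ^ 2 / 16) := by
        field_simp
        ring
    _ ≤ (1 + 1 / 16) ^ 2 * (1 / 4 + (1 / 16) ^ 2 / 16) := by gcongr
    _ ≤ 1 / 3 := by norm_num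

/-- A relative error above `ε` in `v` moves `D/v` away from `1` by at least `ε/(1+ε)`, the worst
case being `v > D`. For `v ≤ 0`, including `v = 0` with `v⁻¹ = 0`, the deviation is at least `1`. -/
theorem one_le_mul_sq_of_lt_abs_sub {ε D v : ℝ} (hε : 0 < ε) (hD : 0 < D)
    (hv : ε * D < |v - D|) : 1 ≤ (1 + 1 / ε) ^ 2 * (D * v⁻¹ - 1) ^ 2 := by
  rw [← mul_pow, one_le_sq_iff_one_le_abs, abs_mul, abs_of_pos (by positivity : 0 < 1 + 1 / ε)]
  have hε1 : 1 ≤ 1 + 1 / ε := le_add_of_nonneg_right (by positivity)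
  rcases le_or_gt v 0 with hv0 | hv0
  · have : D * v⁻¹ ≤ 0 := mul_nonpos_of_nonneg_of_nonpos hD.le (inv_nonpos.2 hv0)
    rw [abs_of_nonpos (by linarith)]
    nlinarith
  · have e : D * v⁻¹ - 1 = (D - v) / v := by field_simp
    rw [e, abs_div, abs_of_pos hv0, ← abs_sub_comm, mul_div_assoc', le_div_iff₀ hv0, one_mul,
      one_add_div hε.ne', div_mul_eq_mul_div, le_div_iff₀ hε]
    have : v - D ≤ |v - D| := le_abs_self _
    nlinarith

theorem lossBound_subToEval {ask : (Fin n → S) → Fin n → Prog S n S} {σ : Fin n → S}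
    {p : Fin n → ℝ} (hask : ∀ j, HitsWith OP OQ (ask σ j) (σ j) (p j)) (hp : ∀ j, 0 < p j)
    (hp1 : ∀ j, p j ≤ 1) (hh : 0 ≤ h) (hn : 1 ≤ n) {ε : ℝ} (hε : 0 < ε) (hε' : ε ≤ 1 / 16)
    {G : ℝ → ℝ} {A K : ℝ} (hA : 0 ≤ A) (hK : 0 ≤ K) (hG : ∀ v, G v ≤ A + K)
    (hG' : ∀ v, |v - ∏ j, p j| ≤ ε * ∏ j, p j → G v ≤ A) :
    Metered.LossBound OP OQ h (subToEval ask ε σ) G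
      (h * ∑ j, (⌈4 * (n : ℝ) / ε ^ 2⌉₊ : ℝ) / p j + (A + K / 3)) := by
  set k : ℕ := ⌈4 * (n : ℝ) / ε ^ 2⌉₊ with hkdef
  have hn' : (0 : ℝ) < n := by exact_mod_cast hn
  have hk : 0 < k := Nat.ceil_pos.2 (by positivity)
  have hD : 0 < ∏ j, p j := Finset.prod_pos fun j _ => hp j
  set D := ∏ j, p j with hDdef
  -- The penalty `K` for a bad estimate is dominated by the quadratic `M (D/v - 1)²`.
  set M := K * (1 + 1 / ε) ^ 2 with hM
  have hM0 : 0 ≤ M := by positivity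
  have key := lossBound_forEach_waitFor hask hp hp1 hh hk (List.finRange n) (A := M) (B := M)
    (C := M + A) hM0 (by positivity) (by nlinarith [mul_nonneg hM0 hA])
  have hprod : ((List.finRange n).map p).prod = D := by
    rw [hDdef, ← List.ofFn_eq_map, List.prod_ofFn]
  have hsum : ((List.finRange n).map fun j => (k : ℝ) / p j).sum = ∑ j, (k : ℝ) / p j := by
    rw [← List.ofFn_eq_map, List.sum_ofFn]
  rw [hprod, hsum, List.length_finRange] at key
  refine (key.bind (F := G) fun xs => .pure ?_).mono (fun _ => le_rfl) ?_
  · set v := (xs.map fun x : ℕ => (k : ℝ) / x).prod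
    have e : M * (D * v⁻¹) ^ 2 - 2 * M * (D * v⁻¹) + (M + A) = A + M * (D * v⁻¹ - 1) ^ 2 := by
      ring
    rw [e]
    rcases le_or_gt |v - D| (ε * D) with hv | hv
    · exact (hG' v hv).trans (le_add_of_nonneg_right (by positivity))
    · refine (hG v).trans (add_le_add le_rfl ?_)
      rw [hM, mul_assoc]
      exact le_mul_of_one_le_right hK (one_le_mul_sq_of_lt_abs_sub hε hD hv)
  · have := mul_le_mul_of_nonneg_left
      (one_add_one_div_pow_sub_one_le hε hε' hk (Nat.le_ceil _)) hK
    rw [← mul_assoc, ← hM] at this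
    linarith

end Estimate

/-! ### Medians of independent estimates -/

/-- The lower middle entry is at most the median and the upper one at least the median. A median
outside the interval thus puts one middle entry outside, with every entry on its far side, which is
at least half of the list. -/
theorem length_le_two_mul_countP_of_median {l : List ℝ} (hl : l ≠ []) {lo hi : ℝ}
    (h : median l < lo ∨ hi < median l) :
    l.length ≤ 2 * l.countP fun x => x < lo ∨ hi < x := by
  by_contra! hcount
  set s := l.insertionSort (· ≤ ·) with hs
  have hperm : s.Perm l := List.perm_insertionSort _ l
  have hlen : s.length = l.length := hperm.length_eq
  have hpos : 0 < l.length := List.length_pos_iff.2 hl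
  have hsort : s.Pairwise (· ≤ ·) := List.pairwise_insertionSort _ l
  have hmono : ∀ i j (hi : i < s.length) (hj : j < s.length), i ≤ j → s[i] ≤ s[j] := by
    intro i j hi hj hij
    rcases hij.eq_or_lt with rfl | hij
    · exact le_rfl
    · exact List.pairwise_iff_getElem.1 hsort i j hi hj hij
  rw [← hperm.countP_eq] at hcount
  have h1 : (l.length - 1) / 2 < s.length := by omega
  have h2 : l.length / 2 < s.length := by omega
  have hmed : median l = (s[(l.length - 1) / 2] + s[l.length / 2]) / 2 := by
    rw [median, ← hs, List.getD_eq_getElem _ _ h1, List.getD_eq_getElem _ _ h2]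
  have hlo : lo ≤ s[(l.length - 1) / 2] := by
    by_contra! hlt
    have hall : ∀ x ∈ s.take ((l.length - 1) / 2 + 1), decide (x < lo ∨ hi < x) = true := by
      intro x hx
      obtain ⟨i, hi, rfl⟩ := List.mem_iff_getElem.1 hx
      rw [List.length_take] at hi
      rw [List.getElem_take]
      exact decide_eq_true (Or.inl ((hmono _ _ (by omega) h1 (by omega)).trans_lt hlt))
    have := (List.countP_eq_length.2 hall).symm.le.trans
      ((List.take_sublist _ s).countP_le (p := fun x => decide (x < lo ∨ hi < x)))
    rw [List.length_take] at this
    omega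
  have hhi : s[l.length / 2] ≤ hi := by
    by_contra! hlt
    have hall : ∀ x ∈ s.drop (l.length / 2), decide (x < lo ∨ hi < x) = true := by
      intro x hx
      obtain ⟨i, hi, rfl⟩ := List.mem_iff_getElem.1 hx
      rw [List.length_drop] at hi
      rw [List.getElem_drop]
      exact decide_eq_true (Or.inr (hlt.trans_le (hmono _ _ h2 (by omega) (by omega))))
    have := (List.countP_eq_length.2 hall).symm.le.trans
      ((List.drop_sublist _ s).countP_le (p := fun x => decide (x < lo ∨ hi < x)))
    rw [List.length_drop] at this
    omega
  have hle := hmono _ _ h1 h2 (by omega)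
  rcases h with h | h <;> linarith

/-- The weight of an estimate: `2 / 3` in the interval `[lo, hi]`, and `3 / 2` outside. -/
noncomputable def weight (lo hi x : ℝ) : ℝ := if x < lo ∨ hi < x then 3 / 2 else 2 / 3

theorem weight_nonneg (lo hi x : ℝ) : 0 ≤ weight lo hi x := by
  rw [weight]
  split <;> norm_num

theorem prod_weight_nonneg {β : Type w} (lo hi : ℝ) (f : β → ℝ) (l : List β) :
    0 ≤ (l.map fun x => weight lo hi (f x)).prod :=
  List.prod_nonneg fun y hy => by
    obtain ⟨x, -, rfl⟩ := List.mem_map.1 hy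
    exact weight_nonneg lo hi (f x)

theorem prod_weight (lo hi : ℝ) (l : List ℝ) :
    (l.map (weight lo hi)).prod =
      (2 / 3) ^ l.length * (9 / 4) ^ (l.countP fun x => x < lo ∨ hi < x) := by
  induction l with
  | nil => simp
  | cons x l ih =>
    by_cases hx : x < lo ∨ hi < x
    · simp only [List.map_cons, List.prod_cons, ih, weight, if_pos hx, List.length_cons,
        List.countP_cons, decide_eq_true hx, if_true]
      ring
    · simp only [List.map_cons, List.prod_cons, ih, weight, if_neg hx, List.length_cons,
        List.countP_cons, decide_eq_false hx]
      simp only [Bool.false_eq_true, if_false, add_zero]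
      ring

/-- When at least half of the factors are `3/2`, they outweigh the factors `2/3`. The product is
thus an exponential-moment majorant of the indicator of a bad median. -/
theorem one_le_prod_weight_of_median {l : List ℝ} {lo hi : ℝ}
    (h : median l < lo ∨ hi < median l) : 1 ≤ (l.map (weight lo hi)).prod := by
  rcases eq_or_ne l [] with rfl | hl
  · simp
  · have hc := length_le_two_mul_countP_of_median hl h
    rw [prod_weight]
    calc (1 : ℝ) = (2 / 3) ^ l.length * (3 / 2) ^ l.length := by
          rw [← mul_pow]; norm_num
      _ ≤ (2 / 3) ^ l.length * (3 / 2) ^ (2 * l.countP fun x => x < lo ∨ hi < x) := by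
          gcongr
          norm_num
      _ = _ := by rw [pow_mul]; norm_num

section Reps

variable {S : Type u} {n : ℕ} [Fintype S] [Nonempty S]
  {OP OQ : QueryString S n → PMF (Fin n → S)} {h : ℝ}

/-- Two product potentials are tracked at once, one for the estimates of `P'` and one for those of
`Q`; each repetition contracts both by `R` in expectation. -/
theorem lossBound_forEach_prod {α : Type v} {ι : Type w} {f : ι → Metered S n α}
    {w₁ w₂ : α → ℝ} (h₁ : ∀ a, 0 ≤ w₁ a) (h₂ : ∀ a, 0 ≤ w₂ a) {c R : ℝ} (hc : 0 ≤ c) (hR : 0 ≤ R)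
    (hf : ∀ i, ∀ A K L : ℝ, 0 ≤ A → 0 ≤ K → 0 ≤ L →
      Metered.LossBound OP OQ h (f i) (fun a => A + K * w₁ a + L * w₂ a)
        (c + (A + K * R + L * R)))
    (l : List ι) {A K L : ℝ} (hA : 0 ≤ A) (hK : 0 ≤ K) (hL : 0 ≤ L) :
    Metered.LossBound OP OQ h (Metered.forEach f l)
      (fun as => A + K * (as.map w₁).prod + L * (as.map w₂).prod)
      (l.length * c + (A + K * R ^ l.length + L * R ^ l.length)) := by
  induction l generalizing A K L with
  | nil => exact .pure (by simp)
  | cons i l ih =>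
    refine (Metered.LossBound.forEach_cons (hf i (l.length * c + A) (K * R ^ l.length)
      (L * R ^ l.length) (by positivity) (by positivity) (by positivity)) fun a => ?_).mono
      (fun _ => le_rfl) (le_of_eq ?_)
    · refine (ih hA (mul_nonneg hK (h₁ a)) (mul_nonneg hL (h₂ a))).mono
        (fun as => le_of_eq ?_) (le_of_eq ?_)
      · simp only [List.map_cons, List.prod_cons]
        ring
      · ring
    · simp only [List.length_cons]
      push_cast
      ring

end Reps

/-- The statistic of a round, as a function of the two estimates. -/
theorem abs_statistic_sub_le {ε p q P Q : ℝ} (hε : 0 < ε) (hε' : ε ≤ 1 / 16) (hP : 0 < P)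
    (hQ : 0 < Q) (hp : |p - P| ≤ ε * P) (hq : |q - Q| ≤ ε * Q) :
    |(if p < q then 1 - p / q else 0) - max 0 (1 - P / Q)| ≤ 32 / 15 * ε := by
  obtain ⟨hp1, hp2⟩ := abs_le.1 hp
  obtain ⟨hq1, hq2⟩ := abs_le.1 hq
  have hp0 : 0 < p := by nlinarith
  have hq0 : 0 < q := by nlinarith
  have hval : (if p < q then 1 - p / q else 0) = max 0 (1 - p / q) := by
    split_ifs with hpq
    · rw [max_eq_right]
      rw [sub_nonneg, div_le_one hq0]
      exact hpq.le
    · rw [max_eq_left]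
      rw [sub_nonpos, one_le_div hq0]
      exact not_lt.1 hpq
  rw [hval]
  have hr : 0 < P / Q := by positivity
  have hrP : P / Q * Q = P := div_mul_cancel₀ _ hQ.ne'
  set r := P / Q
  -- For `ε ≤ 1/16`, `(1+ε)/(1-ε) = 1 + 2ε/(1-ε) ≤ 1 + 32ε/15`. The relative error in `r` becomes an
  -- absolute one because the statistic vanishes for ratios above `1`.
  have hup : p / q ≤ r * (1 + 32 / 15 * ε) := by
    rw [div_le_iff₀ hq0]
    calc p ≤ r * ((1 + ε) * Q) := by rw [← hrP] at hp2; linarith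
      _ ≤ r * ((1 + 32 / 15 * ε) * ((1 - ε) * Q)) := by
          refine mul_le_mul_of_nonneg_left ?_ hr.le
          nlinarith [mul_nonneg (mul_nonneg hε.le (sub_nonneg.2 hε')) hQ.le]
      _ ≤ r * ((1 + 32 / 15 * ε) * q) := by
          gcongr
          linarith
      _ = _ := by ring
  have hlow : r * (1 - 2 * ε) ≤ p / q := by
    rw [le_div_iff₀ hq0]
    calc r * (1 - 2 * ε) * q ≤ r * (1 - 2 * ε) * ((1 + ε) * Q) := by
          gcongr
          · exact mul_nonneg hr.le (by linarith)
          · linarith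
      _ ≤ r * Q * (1 - ε) := by nlinarith [mul_pos hr hQ, mul_pos hε hε]
      _ ≤ p := by rw [hrP]; linarith
  rw [abs_le]
  constructor
  · rcases le_total r 1 with h | h
    · rw [max_eq_right (a := 0) (b := 1 - r) (by linarith)]
      have := le_max_right 0 (1 - p / q)
      nlinarith
    · rw [max_eq_left (a := 0) (b := 1 - r) (by linarith)]
      have := le_max_left 0 (1 - p / q)
      linarith
  · rw [sub_le_iff_le_add, max_le_iff]
    refine ⟨by have := le_max_left 0 (1 - r); linarith, ?_⟩
    rcases le_total r 1 with h | h
    · have := le_max_right 0 (1 - r)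
      nlinarith
    · have := le_max_left 0 (1 - r)
      nlinarith

/-! ### One round: estimates, medians and statistic -/

section Round

variable {S : Type u} {n : ℕ} [Fintype S] [Nonempty S] [DecidableEq S]
  {OP OQ : QueryString S n → PMF (Fin n → S)} {h : ℝ}

/-- The weight is `2/3`, plus `5/6` with probability at most `1/3`, and `2/3 + 5/18 = 17/18`. -/
theorem lossBound_subToEval_weight {ask : (Fin n → S) → Fin n → Prog S n S} {σ : Fin n → S}
    {p : Fin n → ℝ} (hask : ∀ j, HitsWith OP OQ (ask σ j) (σ j) (p j)) (hp : ∀ j, 0 < p j)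
    (hp1 : ∀ j, p j ≤ 1) (hh : 0 ≤ h) (hn : 1 ≤ n) {ε : ℝ} (hε : 0 < ε) (hε' : ε ≤ 1 / 16)
    {A K : ℝ} (hA : 0 ≤ A) (hK : 0 ≤ K) :
    Metered.LossBound OP OQ h (subToEval ask ε σ)
      (fun v => A + K * weight ((1 - ε) * ∏ j, p j) ((1 + ε) * ∏ j, p j) v)
      (h * ∑ j, (⌈4 * (n : ℝ) / ε ^ 2⌉₊ : ℝ) / p j + (A + K * (17 / 18))) := by
  refine (lossBound_subToEval hask hp hp1 hh hn hε hε' (A := A + K * (2 / 3)) (K := K * (5 / 6))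
    (by positivity) (by positivity) (fun v => ?_) fun v hv => ?_).mono (fun _ => le_rfl)
    (le_of_eq (by ring))
  · rw [weight]
    split <;> linarith
  · rw [weight, if_neg]
    rw [abs_le] at hv
    rw [not_or, not_lt, not_lt]
    constructor <;> linarith

/-- A round of the tester after `σ` has been drawn. -/
theorem lossBound_round {askP askQ : (Fin n → S) → Fin n → Prog S n S} {σ : Fin n → S}
    {p q : Fin n → ℝ} (haskP : ∀ j, HitsWith OP OQ (askP σ j) (σ j) (p j))
    (haskQ : ∀ j, HitsWith OP OQ (askQ σ j) (σ j) (q j)) (hp : ∀ j, 0 < p j)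
    (hp1 : ∀ j, p j ≤ 1) (hq : ∀ j, 0 < q j) (hq1 : ∀ j, q j ≤ 1) (hh : 0 ≤ h) (hn : 1 ≤ n)
    {ε : ℝ} (hε : 0 < ε) (hε' : ε ≤ 1 / 16) (t : ℕ) {F : ℝ → ℝ} {A : ℝ} (hA : 0 ≤ A)
    (hF : ∀ g, F g ≤ A + 1)
    (hF' : ∀ g, |g - max 0 (1 - (∏ j, p j) / ∏ j, q j)| ≤ 32 / 15 * ε → F g ≤ A) :
    Metered.LossBound OP OQ h
      ((Metered.forEach (fun _ : ℕ => (subToEval askP ε σ).bind fun p =>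
        (subToEval askQ ε σ).bind fun q => Metered.pure (p, q)) (List.range t)).bind fun pqs =>
        Metered.pure (if median (pqs.map Prod.fst) < median (pqs.map Prod.snd) then
          1 - median (pqs.map Prod.fst) / median (pqs.map Prod.snd) else 0)) F
      (h * (t * (∑ j, (⌈4 * (n : ℝ) / ε ^ 2⌉₊ : ℝ) / p j
        + ∑ j, (⌈4 * (n : ℝ) / ε ^ 2⌉₊ : ℝ) / q j)) + (A + 2 * (17 / 18) ^ t)) := by
  set k : ℝ := (⌈4 * (n : ℝ) / ε ^ 2⌉₊ : ℝ) with hk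
  have hk0 : 0 ≤ k := Nat.cast_nonneg _
  set DP := ∏ j, p j with hDP
  set DQ := ∏ j, q j with hDQ
  have hDP0 : 0 < DP := Finset.prod_pos fun j _ => hp j
  have hDQ0 : 0 < DQ := Finset.prod_pos fun j _ => hq j
  have hcP : 0 ≤ ∑ j, k / p j := Finset.sum_nonneg fun j _ => div_nonneg hk0 (hp j).le
  have hcQ : 0 ≤ ∑ j, k / q j := Finset.sum_nonneg fun j _ => div_nonneg hk0 (hq j).le
  have hreps := lossBound_forEach_prod (OP := OP) (OQ := OQ) (h := h)
    (f := fun _ : ℕ => (subToEval askP ε σ).bind fun p =>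
        (subToEval askQ ε σ).bind fun q => Metered.pure (p, q))
    (w₁ := fun a : ℝ × ℝ => weight ((1 - ε) * DP) ((1 + ε) * DP) a.1)
    (w₂ := fun a : ℝ × ℝ => weight ((1 - ε) * DQ) ((1 + ε) * DQ) a.2)
    (fun a => weight_nonneg _ _ _) (fun a => weight_nonneg _ _ _)
    (c := h * (∑ j, k / p j + ∑ j, k / q j)) (R := 17 / 18) (by positivity) (by norm_num)
    (fun _ A K L hA hK hL => by
      have hP := lossBound_subToEval_weight haskP hp hp1 hh hn hε hε'
        (A := h * ∑ j, k / q j + (A + L * (17 / 18))) (K := K) (by positivity) hK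
      refine (hP.bind fun v => ?_).mono (fun _ => le_rfl) (le_of_eq (by ring))
      have hQ := lossBound_subToEval_weight haskQ hq hq1 hh hn hε hε'
        (A := A + K * weight ((1 - ε) * DP) ((1 + ε) * DP) v) (K := L)
        (add_nonneg hA (mul_nonneg hK (weight_nonneg _ _ _))) hL
      refine (hQ.mono (fun _ => le_rfl) (le_of_eq ?_)).bind fun v' => .pure le_rfl
      rw [← hk, ← hDP]
      ring)
    (List.range t) hA zero_le_one zero_le_one
  refine (hreps.bind fun pqs => .pure ?_).mono (fun _ => le_rfl) (le_of_eq ?_)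
  · have hwP := prod_weight_nonneg ((1 - ε) * DP) ((1 + ε) * DP) Prod.fst pqs
    have hwQ := prod_weight_nonneg ((1 - ε) * DQ) ((1 + ε) * DQ) Prod.snd pqs
    by_cases hbP : median (pqs.map Prod.fst) < (1 - ε) * DP ∨
        (1 + ε) * DP < median (pqs.map Prod.fst)
    · have := one_le_prod_weight_of_median hbP
      rw [List.map_map] at this
      have e : ((weight ((1 - ε) * DP) ((1 + ε) * DP)) ∘ Prod.fst : ℝ × ℝ → ℝ) =
        fun a : ℝ × ℝ => weight ((1 - ε) * DP) ((1 + ε) * DP) a.1 := rfl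
      rw [e] at this
      linarith [hF (if median (pqs.map Prod.fst) < median (pqs.map Prod.snd) then
          1 - median (pqs.map Prod.fst) / median (pqs.map Prod.snd) else 0)]
    by_cases hbQ : median (pqs.map Prod.snd) < (1 - ε) * DQ ∨
        (1 + ε) * DQ < median (pqs.map Prod.snd)
    · have := one_le_prod_weight_of_median hbQ
      rw [List.map_map] at this
      have e : ((weight ((1 - ε) * DQ) ((1 + ε) * DQ)) ∘ Prod.snd : ℝ × ℝ → ℝ) =
        fun a : ℝ × ℝ => weight ((1 - ε) * DQ) ((1 + ε) * DQ) a.2 := rfl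
      rw [e] at this
      linarith [hF (if median (pqs.map Prod.fst) < median (pqs.map Prod.snd) then
          1 - median (pqs.map Prod.fst) / median (pqs.map Prod.snd) else 0)]
    rw [not_or, not_lt, not_lt] at hbP hbQ
    refine (hF' _ (abs_statistic_sub_le hε hε' hDP0 hDQ0 ?_ ?_)).trans (by linarith)
    · rw [abs_le]
      constructor <;> linarith
    · rw [abs_le]
      constructor <;> linarith
  · rw [List.length_range]
    ring

end Round

/-! ### Conditional marginals -/

theorem prefixQuery_congr {S : Type u} {n : ℕ} {σ τ : Fin n → S} {j : Fin n}
    (h : ∀ i < j, σ i = τ i) :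
    prefixQuery σ j = prefixQuery τ j := by
  funext i
  simp only [prefixQuery]
  split
  · rw [h i ‹_›]
  · rfl

theorem mem_subcube_prefixQuery {S : Type u} {n : ℕ} {σ x : Fin n → S} {j : Fin n} :
    x ∈ subcube (prefixQuery σ j) ↔ ∀ i < j, x i = σ i := by
  simp only [subcube, prefixQuery, Set.mem_ofPred_eq]
  constructor
  · intro h i hi
    exact h i _ (if_pos hi)
  · intro h i c hc
    split_ifs at hc with hi
    · rw [h i hi, Option.some.inj hc]

section Marginals

variable {S : Type u} {n : ℕ} [Fintype S] [DecidableEq S]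

/-- The probability that coordinate `j` of the answer of `O` to the query
`σ[1] ⋯ σ[j-1] * ⋯ *` is `c`. -/
noncomputable def marginal (O : QueryString S n → PMF (Fin n → S)) (σ : Fin n → S) (j : Fin n)
    (c : S) : ℝ :=
  ∑ x, if x j = c then (O (prefixQuery σ j) x).toReal else 0

/-- The tamed conditional probability of the letter `σ[j]` given the prefix `σ[1] ⋯ σ[j-1]`. -/
noncomputable def tamed (θ : ℝ) (O : QueryString S n → PMF (Fin n → S)) (σ : Fin n → S)
    (j : Fin n) : ℝ :=
  (1 - Fintype.card S * θ) * marginal O σ j (σ j) + θ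

variable {O OP OQ : QueryString S n → PMF (Fin n → S)}

theorem marginal_nonneg (σ : Fin n → S) (j : Fin n) (c : S) : 0 ≤ marginal O σ j c :=
  Finset.sum_nonneg fun x _ => by split <;> positivity

theorem sum_marginal (σ : Fin n → S) (j : Fin n) : ∑ c, marginal O σ j c = 1 := by
  simp only [marginal]
  rw [Finset.sum_comm]
  simp [Prog.sum_toReal_eq_one]

theorem marginal_le_one (σ : Fin n → S) (j : Fin n) (c : S) : marginal O σ j c ≤ 1 := by
  rw [← sum_marginal (O := O) σ j]
  exact Finset.single_le_sum (f := marginal O σ j) (fun c _ => marginal_nonneg σ j c)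
    (Finset.mem_univ c)

theorem marginal_congr {σ τ : Fin n → S} {j : Fin n} (h : ∀ i < j, σ i = τ i) (c : S) :
    marginal O σ j c = marginal O τ j c := by
  simp only [marginal, prefixQuery_congr h]

theorem expect_askMarginal_sum (f : (Fin n → S) → ℝ) (hf : ∑ x, f x = 1) (j : Fin n) (c : S)
    (X Y : ℝ) :
    ∑ x, f x * (if x j = c then X else Y) =
      (∑ x, if x j = c then f x else 0) * X + (1 - ∑ x, if x j = c then f x else 0) * Y := by
  rw [← hf, ← Finset.sum_sub_distrib, Finset.sum_mul, Finset.sum_mul, ← Finset.sum_add_distrib]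
  refine Finset.sum_congr rfl fun x _ => ?_
  split <;> simp

theorem hitsWith_askMarginal_P (σ : Fin n → S) (j : Fin n) (c : S) :
    HitsWith OP OQ (askMarginal .P σ j) c (marginal OP σ j c) := fun X Y =>
  expect_askMarginal_sum _ (Prog.sum_toReal_eq_one _) j c X Y

theorem hitsWith_askMarginal_Q (σ : Fin n → S) (j : Fin n) (c : S) :
    HitsWith OP OQ (askMarginal .Q σ j) c (marginal OQ σ j c) := fun X Y =>
  expect_askMarginal_sum _ (Prog.sum_toReal_eq_one _) j c X Y

theorem hitsWith_askTamed [Nonempty S] {θ : ℝ} (hθ : 0 ≤ θ) (hθ' : Fintype.card S * θ ≤ 1)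
    (σ : Fin n → S) (j : Fin n) :
    HitsWith OP OQ (askTamed θ σ j) (σ j) (tamed θ OP σ j) := fun X Y => by
  have hS : (Fintype.card S : ℝ) ≠ 0 := by simp
  have hproj : ((Set.projIcc (0 : ℝ) 1 zero_le_one (Fintype.card S * θ) : Set.Icc (0 : ℝ) 1) : ℝ)
      = Fintype.card S * θ := by
    rw [Set.projIcc_of_mem zero_le_one ⟨by positivity, hθ'⟩]
  have hletter : ∑ a : S, (Fintype.card S : ℝ)⁻¹ * (if a = σ j then X else Y) =
      (Fintype.card S : ℝ)⁻¹ * (X + (Fintype.card S - 1) * Y) := by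
    rw [← Finset.mul_sum, ← Finset.add_sum_erase _ _ (Finset.mem_univ (σ j)), if_pos rfl,
      Finset.sum_congr rfl fun a ha => if_neg (Finset.ne_of_mem_erase ha), Finset.sum_const,
      Finset.card_erase_of_mem (Finset.mem_univ _), Finset.card_univ, nsmul_eq_mul,
      Nat.cast_sub Fintype.card_pos, Nat.cast_one]
  have hmarg := hitsWith_askMarginal_P (OP := OP) (OQ := OQ) σ j (σ j) X Y
  simp only [askTamed, Prog.expect, if_true, Bool.false_eq_true, if_false]
  rw [hproj, hmarg, hletter, tamed]
  field_simp
  ring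

theorem tamed_le_one {θ : ℝ} (hθ : 0 ≤ θ) (hθ' : Fintype.card S * θ ≤ 1) (σ : Fin n → S)
    (j : Fin n) : tamed θ O σ j ≤ 1 := by
  have h1 := mul_le_mul_of_nonneg_left (marginal_le_one (O := O) σ j (σ j)) (sub_nonneg.2 hθ')
  have h2 : (1 : ℝ) ≤ Fintype.card S := by
    exact_mod_cast Fintype.card_pos_iff.2 ⟨σ j⟩
  rw [tamed]
  nlinarith

theorem le_tamed {θ : ℝ} (hθ' : Fintype.card S * θ ≤ 1) (σ : Fin n → S) (j : Fin n) :
    θ ≤ tamed θ O σ j :=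
  le_add_of_nonneg_left (mul_nonneg (sub_nonneg.2 hθ') (marginal_nonneg _ _ _))

end Marginals

/-! ### Products of conditional probabilities -/

/-- Sum the last letters first: the remaining factors do not depend on them. It yields both the mass
bound for the tamed weights and the factor `|S|` in the cost for `Q`. -/
theorem sum_prod_le_prod {S : Type u} [Fintype S] [DecidableEq S] {n : ℕ}
    (f : Fin n → (Fin n → S) → ℝ) (R : Fin n → ℝ) (hf : ∀ i σ, 0 ≤ f i σ) (hR : ∀ i, 0 ≤ R i)
    (hdep : ∀ i σ τ, (∀ l ≤ i, σ l = τ l) → f i σ = f i τ)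
    (hsum : ∀ i σ, ∑ c, f i (Function.update σ i c) ≤ R i) :
    ∑ σ, ∏ i, f i σ ≤ ∏ i, R i := by
  induction n with
  | zero => simp
  | succ n ih =>
    rcases isEmpty_or_nonempty S with hS | ⟨⟨s⟩⟩
    · have : IsEmpty (Fin (n + 1) → S) := ⟨fun σ => hS.elim (σ 0)⟩
      simpa using Finset.prod_nonneg fun i _ => hR i
    have hfirst : ∀ (c : S) (τ : Fin n → S),
        f 0 (Fin.cons c τ) = f 0 (Function.update (fun _ => s) 0 c) := fun c τ =>
      hdep _ _ _ fun l hl => by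
        obtain rfl : l = 0 := Fin.le_zero_iff.1 hl
        simp
    have hinner : ∀ c : S, ∑ τ : Fin n → S, ∏ i : Fin n, f i.succ (Fin.cons c τ) ≤
        ∏ i : Fin n, R i.succ := fun c => by
      refine ih (fun i τ => f i.succ (Fin.cons c τ)) (fun i => R i.succ) (fun i τ => hf _ _)
        (fun i => hR _) (fun i σ τ h => hdep _ _ _ fun l hl => ?_) fun i σ => ?_
      · refine Fin.cases (fun _ => ?_) (fun l hl => ?_) l hl
        · simp
        · simpa using h l (Fin.succ_le_succ_iff.1 hl)
      · simpa only [Fin.cons_update] using hsum i.succ (Fin.cons c σ)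
    rw [← (Fin.consEquiv fun _ : Fin (n + 1) => S).sum_comp, Fintype.sum_prod_type,
      Fin.prod_univ_succ]
    calc ∑ c : S, ∑ τ : Fin n → S, ∏ i, f i (Fin.cons c τ)
        = ∑ c : S, f 0 (Function.update (fun _ => s) 0 c) *
            ∑ τ : Fin n → S, ∏ i : Fin n, f i.succ (Fin.cons c τ) := by
          refine Finset.sum_congr rfl fun c _ => ?_
          rw [Finset.mul_sum]
          refine Finset.sum_congr rfl fun τ _ => ?_
          rw [Fin.prod_univ_succ, hfirst]
      _ ≤ ∑ c : S, f 0 (Function.update (fun _ => s) 0 c) * ∏ i : Fin n, R i.succ := by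
          gcongr with c
          · exact hf _ _
          · exact hinner c
      _ ≤ R 0 * ∏ i : Fin n, R i.succ := by
          rw [← Finset.sum_mul]
          exact mul_le_mul_of_nonneg_right (hsum 0 _) (Finset.prod_nonneg fun i _ => hR _)

-- Multiplying by the mass of the subcube avoids the conditional probability: on a null subcube both
-- sides vanish, whatever the oracle answers.
open Classical in
theorem IsSubcondOracle.apply_mul_mass {S : Type u} {n : ℕ} [Fintype S]
    {D : PMF (Fin n → S)} {O : QueryString S n → PMF (Fin n → S)} (hO : IsSubcondOracle D O)
    (ρ : QueryString S n)
    (x : Fin n → S) :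
    (O ρ x).toReal * ∑ y, (if y ∈ subcube ρ then (D y).toReal else 0) =
      if x ∈ subcube ρ then (D x).toReal else 0 := by
  by_cases h : ∃ x ∈ subcube ρ, x ∈ D.support
  · have hsum : ∑ y, (if y ∈ subcube ρ then (D y).toReal else 0) =
        (∑' y, (subcube ρ).indicator D y).toReal := by
      rw [tsum_fintype, ENNReal.toReal_sum]
      · refine Finset.sum_congr rfl fun y _ => ?_
        rw [Set.indicator_apply]
        split <;> simp
      · intro y _
        rw [Set.indicator_apply]
        split
        · exact D.apply_ne_top y
        · simp
    have hne : (∑' y, (subcube ρ).indicator D y) ≠ 0 := by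
      obtain ⟨x, hx, hx'⟩ := h
      refine fun h0 => (D.mem_support_iff x).1 hx' ?_
      have := ENNReal.tsum_eq_zero.1 h0 x
      rwa [Set.indicator_of_mem hx] at this
    have htop : (∑' y, (subcube ρ).indicator D y) ≠ ⊤ :=
      ne_top_of_le_ne_top ENNReal.one_ne_top
        ((ENNReal.tsum_le_tsum fun y => Set.indicator_le_self _ _ y).trans D.tsum_coe.le)
    rw [hsum, hO ρ h, PMF.filter_apply, ENNReal.toReal_mul, ENNReal.toReal_inv, mul_assoc,
      inv_mul_cancel₀ (ENNReal.toReal_ne_zero.2 ⟨hne, htop⟩), mul_one, Set.indicator_apply]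
    split <;> simp
  · have hz : ∀ y, (if y ∈ subcube ρ then (D y).toReal else 0) = 0 := fun y => by
      split_ifs with hy
      · by_contra hne
        exact h ⟨y, hy, (D.mem_support_iff y).2 fun h0 => hne (by simp [h0])⟩
      · rfl
    simp [hz]

theorem IsSubcondOracle.apply_none {S : Type u} {n : ℕ} [Fintype S]
    {D : PMF (Fin n → S)} {O : QueryString S n → PMF (Fin n → S)} (hO : IsSubcondOracle D O)
    (x : Fin n → S) :
    O (fun _ => none) x = D x := by
  classical
  have h := hO.apply_mul_mass (fun _ => none) x
  have hmem : ∀ y : Fin n → S, y ∈ subcube (fun _ : Fin n => (none : Option S)) := fun y => by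
    simp [subcube]
  simp only [hmem, if_true, Prog.sum_toReal_eq_one, mul_one] at h
  exact (ENNReal.toReal_eq_toReal_iff' (PMF.apply_ne_top _ _) (PMF.apply_ne_top _ _)).1 h

/-! ### Chain rule, expected cost under the sampled distribution, and the effect of taming -/

section Oracles

variable {S : Type u} {n : ℕ} [Fintype S] [DecidableEq S]
  {D : PMF (Fin n → S)} {O : QueryString S n → PMF (Fin n → S)}

/-- The chain rule. -/
theorem IsSubcondOracle.toReal_apply (hO : IsSubcondOracle D O) (σ : Fin n → S) :
    (D σ).toReal = ∏ j, marginal O σ j (σ j) := by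
  classical
  -- The mass of the prefix of length `k` is the product of the first `k` conditional probabilities.
  have key : ∀ k (hk : k ≤ n), ∑ x, (if ∀ i : Fin n, i.val < k → x i = σ i then
      (D x).toReal else 0) = ∏ j : Fin k, marginal O σ (j.castLE hk) (σ (j.castLE hk)) := by
    intro k
    induction k with
    | zero =>
      intro _
      simp [Prog.sum_toReal_eq_one]
    | succ k ih =>
      intro hk
      rw [Fin.prod_univ_castSucc]
      simp only [Fin.castLE_castSucc]
      rw [← ih (by omega)]
      set j : Fin n := (Fin.last k).castLE hk with hj
      have hjv : j.val = k := rfl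
      rw [marginal, Finset.mul_sum]
      refine Finset.sum_congr rfl fun x _ => ?_
      have hmass := hO.apply_mul_mass (prefixQuery σ j) x
      simp only [mem_subcube_prefixQuery, Fin.lt_def, hjv] at hmass
      rw [mul_ite, mul_zero, mul_comm, hmass]
      by_cases hx : ∀ i : Fin n, i.val < k → x i = σ i
      · rw [if_pos hx]
        refine if_congr ⟨fun h => h j (by omega), fun h i hi => ?_⟩ rfl rfl
        rcases Nat.lt_succ_iff_lt_or_eq.1 hi with hi | hi
        · exact hx i hi
        · obtain rfl : i = j := Fin.ext hi
          exact h
      · rw [if_neg hx, ite_self, if_neg fun h => hx fun i hi => h i (by omega)]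
  have h := key n le_rfl
  simp only [Fin.castLE_rfl, id] at h
  rw [← h, Finset.sum_eq_single σ]
  · simp
  · intro x _ hx
    exact if_neg fun h => hx (funext fun i => h i i.2)
  · simp

/-- The expected cost of estimating the probability of a random string. -/
theorem IsSubcondOracle.sum_mul_sum_div_le (hO : IsSubcondOracle D O) {k : ℝ} (hk : 0 ≤ k) :
    ∑ σ, (D σ).toReal * ∑ j, k / marginal O σ j (σ j) ≤ k * n * Fintype.card S := by
  have hj : ∀ j : Fin n, ∑ σ, (D σ).toReal * (k / marginal O σ j (σ j)) ≤
      k * Fintype.card S := fun j => by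
    -- The `j`-th factor is cancelled by the division, so its sum over letters is `|S|` instead of
    -- `1`.
    have hle := sum_prod_le_prod (S := S) (n := n)
      (fun i σ => if i = j then 1 else marginal O σ i (σ i))
      (fun i => if i = j then (Fintype.card S : ℝ) else 1)
      (fun i σ => by
        split
        · exact zero_le_one
        · exact marginal_nonneg _ _ _)
      (fun i => by split <;> positivity)
      (fun i σ τ h => by
        rw [h i le_rfl, marginal_congr fun l hl => h l hl.le])
      (fun i σ => by
        by_cases hij : i = j
        · simp [hij]
        · simp only [hij, if_false, Function.update_self]
          rw [← sum_marginal (O := O) σ i]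
          exact (Finset.sum_congr rfl fun c _ => marginal_congr (fun l hl => by
            rw [Function.update_of_ne hl.ne]) c).le)
    have hR : ∏ i : Fin n, (if i = j then (Fintype.card S : ℝ) else 1) = Fintype.card S := by
      simp
    rw [hR] at hle
    refine le_trans ?_ (mul_le_mul_of_nonneg_left hle hk)
    rw [Finset.mul_sum]
    refine Finset.sum_le_sum fun σ _ => ?_
    have hprod : ∏ i, marginal O σ i (σ i) = marginal O σ j (σ j) *
        ∏ i, (if i = j then 1 else marginal O σ i (σ i)) := by
      rw [← Finset.mul_prod_erase _ _ (Finset.mem_univ j),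
        ← Finset.mul_prod_erase Finset.univ (fun i => if i = j then 1 else marginal O σ i (σ i))
          (Finset.mem_univ j), if_pos rfl, one_mul]
      congr 1
      exact Finset.prod_congr rfl fun i hi => (if_neg (Finset.ne_of_mem_erase hi)).symm
    have hnn : 0 ≤ ∏ i, (if i = j then 1 else marginal O σ i (σ i)) :=
      Finset.prod_nonneg fun i _ => by
        split
        · exact zero_le_one
        · exact marginal_nonneg _ _ _
    rw [hO.toReal_apply σ, hprod]
    -- A zero marginal makes `D σ` zero, so the convention `k / 0 = 0` is harmless.
    rcases (marginal_nonneg (O := O) σ j (σ j)).eq_or_lt with h0 | h0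
    · rw [← h0, zero_mul, zero_mul]
      positivity
    · rw [mul_comm (marginal O σ j (σ j)), mul_assoc, mul_div_cancel₀ _ h0.ne', mul_comm]
  calc ∑ σ, (D σ).toReal * ∑ j, k / marginal O σ j (σ j)
      = ∑ j, ∑ σ, (D σ).toReal * (k / marginal O σ j (σ j)) := by
        simp only [Finset.mul_sum]
        exact Finset.sum_comm
    _ ≤ ∑ _j : Fin n, k * Fintype.card S := Finset.sum_le_sum fun j _ => hj j
    _ = _ := by
        rw [Finset.sum_const, Finset.card_univ, Fintype.card_fin, nsmul_eq_mul]
        ring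

theorem sum_prod_tamed_le_one {θ : ℝ} (hθ : 0 ≤ θ) (hθ' : Fintype.card S * θ ≤ 1) :
    ∑ σ, ∏ j, tamed θ O σ j ≤ 1 := by
  have hle := sum_prod_le_prod (S := S) (n := n) (fun j σ => tamed θ O σ j) (fun _ => 1)
    (fun i σ => hθ.trans (le_tamed hθ' σ i)) (fun _ => zero_le_one)
    (fun i σ τ h => by
      dsimp only [tamed]
      rw [h i le_rfl, marginal_congr fun l hl => h l hl.le])
    (fun i σ => by
      have hm : ∀ c, marginal O (Function.update σ i c) i c = marginal O σ i c := fun c =>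
        marginal_congr (fun l hl => by rw [Function.update_of_ne hl.ne]) c
      simp only [tamed, Function.update_self, hm]
      rw [Finset.sum_add_distrib, ← Finset.mul_sum, sum_marginal, Finset.sum_const,
        Finset.card_univ, nsmul_eq_mul]
      linarith)
  simpa using hle

/-- Drop the summand `θ` in each factor and apply Bernoulli's inequality. -/
theorem IsSubcondOracle.mul_le_prod_tamed (hO : IsSubcondOracle D O) {θ : ℝ} (hθ : 0 ≤ θ)
    (hθ' : Fintype.card S * θ ≤ 1) (σ : Fin n → S) :
    (1 - n * (Fintype.card S * θ)) * (D σ).toReal ≤ ∏ j, tamed θ O σ j := by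
  have h0 : 0 ≤ 1 - Fintype.card S * θ := sub_nonneg.2 hθ'
  calc (1 - n * (Fintype.card S * θ)) * (D σ).toReal
      ≤ (1 - Fintype.card S * θ) ^ n * (D σ).toReal := by
        gcongr
        have := one_add_mul_le_pow (a := -(Fintype.card S * θ)) (by linarith) n
        rw [← sub_eq_add_neg] at this
        linarith
    _ = ∏ j, (1 - Fintype.card S * θ) * marginal O σ j (σ j) := by
        rw [hO.toReal_apply, Finset.prod_mul_distrib, Finset.prod_const, Finset.card_univ,
          Fintype.card_fin]
    _ ≤ _ := Finset.prod_le_prod (fun j _ => mul_nonneg h0 (marginal_nonneg _ _ _))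
        fun j _ => le_add_of_nonneg_right hθ

theorem tvDist_eq_sum_max {Ω : Type*} [Fintype Ω] (P Q : PMF Ω) :
    tvDist P Q = ∑ x, max 0 ((Q x).toReal - (P x).toReal) := by
  have h : ∀ a b : ℝ, |a - b| = 2 * max 0 (b - a) + (a - b) := fun a b => by
    rcases le_total a b with h | h
    · rw [abs_of_nonpos (by linarith), max_eq_right (by linarith)]
      ring
    · rw [abs_of_nonneg (by linarith), max_eq_left (by linarith)]
      ring
  simp only [tvDist, h]
  rw [Finset.sum_add_distrib, Finset.sum_sub_distrib, Prog.sum_toReal_eq_one,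
    Prog.sum_toReal_eq_one, ← Finset.mul_sum]
  ring

/-- If `(1 - δ) P ≤ P'` and `P'` has mass at most `1`, then replacing `P` by `P'` changes the
distance to `Q` by at most `δ`. -/
theorem abs_sum_max_sub_tvDist_le {Ω : Type*} [Fintype Ω] (P Q : PMF Ω) (P' : Ω → ℝ)
    (hP' : ∀ x, 0 ≤ P' x) {δ : ℝ} (hδ : 0 ≤ δ) (hle : ∀ x, (1 - δ) * (P x).toReal ≤ P' x)
    (hsum : ∑ x, P' x ≤ 1) :
    |∑ x, (Q x).toReal * max 0 (1 - P' x / (Q x).toReal) - tvDist P Q| ≤ δ := by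
  have he : ∀ x, (Q x).toReal * max 0 (1 - P' x / (Q x).toReal) =
      max 0 ((Q x).toReal - P' x) := fun x => by
    rcases (ENNReal.toReal_nonneg (a := Q x)).eq_or_lt with h | h
    · rw [← h, zero_mul, max_eq_left]
      linarith [hP' x]
    · rw [mul_max_of_nonneg _ _ h.le, mul_zero, mul_sub, mul_one, mul_div_cancel₀ _ h.ne']
  have hPsum := Prog.sum_toReal_eq_one P
  rw [Finset.sum_congr rfl fun x _ => he x, tvDist_eq_sum_max, abs_le]
  constructor
  · rw [neg_le_sub_iff_le_add]
    calc ∑ x, max 0 ((Q x).toReal - (P x).toReal)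
        -- The added term `P' - (1 - δ) P` is nonnegative pointwise and sums to at most `δ`; here
        -- the bound on the mass of `P'` is needed.
        ≤ ∑ x, (max 0 ((Q x).toReal - P' x) + (P' x - (P x).toReal + δ * (P x).toReal)) := by
          refine Finset.sum_le_sum fun x _ => max_le ?_ ?_
          · have := le_max_left 0 ((Q x).toReal - P' x)
            linarith [hle x]
          · have := le_max_right 0 ((Q x).toReal - P' x)
            have : 0 ≤ δ * (P x).toReal := by positivity
            linarith
      _ ≤ _ := by
          rw [Finset.sum_add_distrib, Finset.sum_add_distrib, Finset.sum_sub_distrib,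
            ← Finset.mul_sum, hPsum]
          linarith
  · rw [sub_le_iff_le_add]
    calc ∑ x, max 0 ((Q x).toReal - P' x)
        ≤ ∑ x, (δ * (P x).toReal + max 0 ((Q x).toReal - (P x).toReal)) := by
          refine Finset.sum_le_sum fun x _ => max_le ?_ ?_
          · have : 0 ≤ δ * (P x).toReal := by positivity
            exact add_nonneg this (le_max_left _ _)
          · have := le_max_right 0 ((Q x).toReal - (P x).toReal)
            linarith [hle x]
      _ = _ := by
          rw [Finset.sum_add_distrib, ← Finset.mul_sum, hPsum, mul_one]

end Oracles

/-! ### Numbers of queries -/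

namespace Prog

variable {S : Type u} {n : ℕ} {α : Type v} {β : Type w}

/-- On every run the program makes at most `q` queries, and its output `a` satisfies `post a q'`,
where `q'` is the number of queries that are left. -/
def Within : Prog S n α → ℕ → (α → ℕ → Prop) → Prop
  | done a, q, post => post a q
  | coin _ k, q, post => ∀ b, (k b).Within q post
  | letter k, q, post => ∀ c, (k c).Within q post
  | query _ _ _, 0, _ => False
  | query _ _ k, q + 1, post => ∀ x, (k x).Within q post

theorem Within.bind {p : Prog S n α} {f : α → Prog S n β} {q : ℕ} {post : α → ℕ → Prop}
    {post' : β → ℕ → Prop} (hp : p.Within q post)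
    (hf : ∀ a q', post a q' → (f a).Within q' post') : (p.bind f).Within q post' := by
  induction p generalizing q with
  | done a => exact hf a q hp
  | coin p k ih => exact fun b => ih b (hp b)
  | letter k ih => exact fun c => ih c (hp c)
  | query s ρ k ih =>
    cases q with
    | zero => exact hp
    | succ q => exact fun x => ih x (hp x)

theorem Within.mono {p : Prog S n α} {q q' : ℕ} {post : α → ℕ → Prop} (hp : p.Within q post)
    (hqq' : q ≤ q') (hpost : ∀ a q q', q ≤ q' → post a q → post a q') : p.Within q' post := by
  induction p generalizing q q' with
  | done a => exact hpost a q q' hqq' hp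
  | coin p k ih => exact fun b => ih b (hp b) hqq'
  | letter k ih => exact fun c => ih c (hp c) hqq'
  | query s ρ k ih =>
    cases q with
    | zero => exact hp.elim
    | succ q =>
      obtain ⟨q', rfl⟩ : ∃ r, q' = r + 1 := ⟨q' - 1, by omega⟩
      exact fun x => ih x (hp x) (by omega)

theorem Within.queriesAtMost {p : Prog S n α} {q : ℕ} {post : α → ℕ → Prop}
    (hp : p.Within q post) : p.QueriesAtMost q := by
  induction p generalizing q with
  | done a => trivial
  | coin p k ih => exact fun b => ih b (hp b)
  | letter k ih => exact fun c => ih c (hp c)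
  | query s ρ k ih =>
    cases q with
    | zero => exact hp
    | succ q => exact fun x => ih x (hp x)

/-- Restricts the comparison to reachable outcomes; it supplies that the remaining budget never
exceeds the initial one. -/
theorem Within.expect_mono [Fintype S] {OP OQ : QueryString S n → PMF (Fin n → S)}
    {p : Prog S n α} {q : ℕ} {post : α → ℕ → Prop} (hp : p.Within q post) {F G : α → ℝ}
    (h : ∀ a q', q' ≤ q → post a q' → F a ≤ G a) :
    p.expect OP OQ F ≤ p.expect OP OQ G := by
  induction p generalizing q with
  | done a => exact h a q le_rfl hp
  | coin p k ih =>
    have h0 : (0 : ℝ) ≤ p := p.2.1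
    have h1 : (0 : ℝ) ≤ 1 - p := sub_nonneg.2 p.2.2
    exact add_le_add (mul_le_mul_of_nonneg_left (ih _ (hp _) h) h0)
      (mul_le_mul_of_nonneg_left (ih _ (hp _) h) h1)
  | letter k ih =>
    exact Finset.sum_le_sum fun c _ => mul_le_mul_of_nonneg_left (ih c (hp c) h) (by positivity)
  | query s ρ k ih =>
    cases q with
    | zero => exact hp.elim
    | succ q =>
      cases s <;>
      exact Finset.sum_le_sum fun c _ => mul_le_mul_of_nonneg_left
        (ih c (hp c) fun a q' hq' => h a q' (by omega)) (by positivity)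

end Prog

namespace Metered

variable {S : Type u} {n : ℕ} {α : Type v} {β : Type w}

/-- The remaining budget in the outcome, if any, is at most `q`. -/
def Affordable (r : Option (α × ℕ)) (q : ℕ) : Prop := ∀ a b, r = some (a, b) → b ≤ q

/-- Every query is paid for from the budget. -/
def Frugal (x : Metered S n α) : Prop := ∀ b, (x b).Within b Affordable

theorem Affordable.mono (r : Option (α × ℕ)) (q q' : ℕ) (hq : q ≤ q') (h : Affordable r q) :
    Affordable r q' := fun a b hab => (h a b hab).trans hq

theorem Frugal.pure (a : α) : (Metered.pure a : Metered S n α).Frugal := fun b a' b' h => by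
  cases h
  exact le_rfl

theorem Frugal.bind {x : Metered S n α} {f : α → Metered S n β} (hx : x.Frugal)
    (hf : ∀ a, (f a).Frugal) : (x.bind f).Frugal := fun b => by
  refine (hx b).bind fun r q' hr => ?_
  rcases r with _ | ⟨a, b'⟩
  · intro _ _ h
    cases h
  · exact (hf a b').mono (hr a b' rfl) Affordable.mono

/-- One unit of budget pays for at most one query; a tamed call answered by a uniform letter makes
none. -/
theorem Frugal.call {ask : Prog S n α} (hask : ∀ b, ask.Within (b + 1) fun _ q => b ≤ q) :
    (Metered.call ask).Frugal := fun b => by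
  cases b with
  | zero =>
    intro _ _ h
    cases h
  | succ b =>
    refine (hask b).bind fun a q' hq' => ?_
    intro _ _ h
    cases h
    exact hq'

theorem Frugal.forEach {ι : Type w} {f : ι → Metered S n α} (hf : ∀ i, (f i).Frugal)
    (l : List ι) : (Metered.forEach f l).Frugal := by
  induction l with
  | nil => exact .pure _
  | cons i l ih => exact (hf i).bind fun a => ih.bind fun as => .pure _

end Metered

section Tester

variable {S : Type u} {n : ℕ}

theorem within_askMarginal (s : Source) (σ : Fin n → S) (j : Fin n) (b : ℕ) :
    (askMarginal s σ j).Within (b + 1) fun _ q => b ≤ q := fun _ => le_rfl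

theorem within_askTamed [Fintype S] (θ : ℝ) (σ : Fin n → S) (j : Fin n) (b : ℕ) :
    (askTamed θ σ j).Within (b + 1) fun _ q => b ≤ q := fun c => by
  cases c
  · exact within_askMarginal _ σ j b
  · exact fun _ => Nat.le_succ b

variable [DecidableEq S]

theorem within_waitFor {ask : Prog S n S} (hask : ∀ b, ask.Within (b + 1) fun _ q => b ≤ q)
    (c : S) (b r x : ℕ) : (waitFor ask c b r x).Within b Metered.Affordable := by
  induction b generalizing r x with
  | zero =>
    rcases r with _ | r <;> intro _ _ h <;> cases h
    exact le_rfl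
  | succ b ih =>
    rcases r with _ | r
    · intro _ _ h
      cases h
      exact le_rfl
    · rw [waitFor]
      refine (hask b).bind fun a q' hq' => ?_
      split
      · exact (ih _ _).mono hq' Metered.Affordable.mono
      · exact (ih _ _).mono hq' Metered.Affordable.mono

theorem frugal_subToEval {ask : (Fin n → S) → Fin n → Prog S n S}
    (hask : ∀ σ j b, (ask σ j).Within (b + 1) fun _ q => b ≤ q) (ε : ℝ) (σ : Fin n → S) :
    (subToEval ask ε σ).Frugal :=
  (Metered.Frugal.forEach (fun j b => within_waitFor (hask σ j) (σ j) b _ 0) _).bind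
    fun _ => .pure _

variable [Fintype S]

theorem frugal_testRound (γ : ℝ) : (testRound γ : Metered S n ℝ).Frugal :=
  (Metered.Frugal.call (ask := .query .Q _ .done) fun b _ => le_refl b).bind fun σ =>
    (Metered.Frugal.forEach (fun _ => (frugal_subToEval (within_askTamed _) _ σ).bind fun _ =>
      (frugal_subToEval (within_askMarginal _) _ σ).bind fun _ => .pure _) _).bind fun _ => .pure _

theorem within_subVsSub (ε₁ ε₂ : ℝ) :
    (subVsSub S n ε₁ ε₂).Within ⌊gridBudget (Fintype.card S) n (gap ε₁ ε₂)⌋₊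
      fun _ _ => True := by
  refine (Metered.Frugal.forEach (fun _ : ℕ => frugal_testRound (gap ε₁ ε₂)) _ _).bind
    fun r q' _ => ?_
  rcases r with _ | ⟨gs, b'⟩
  · trivial
  · dsimp only
    split <;> trivial

end Tester

/-! ### Tails of sums of independent statistics -/

section Tail

variable {Ω : Type u} [Fintype Ω]

/-- The probability that `u + ∑ (z Γ + η) ≥ T` for a sum of `i` independent copies of the
statistic `Γ`, whose distribution is given by the weights `q`. -/
noncomputable def tail (q Γ : Ω → ℝ) (z η T : ℝ) : ℕ → ℝ → ℝ
  | 0, u => if T ≤ u then 1 else 0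
  | i + 1, u => ∑ x, q x * tail q Γ z η T i (u + z * Γ x + η)

variable {q Γ : Ω → ℝ} {z η T : ℝ}

theorem tail_nonneg (hq : ∀ x, 0 ≤ q x) (i : ℕ) (u : ℝ) : 0 ≤ tail q Γ z η T i u := by
  induction i generalizing u with
  | zero => rw [tail]; split <;> norm_num
  | succ i ih => exact Finset.sum_nonneg fun x _ => mul_nonneg (hq x) (ih _)

theorem tail_le_one (hq : ∀ x, 0 ≤ q x) (hq1 : ∑ x, q x = 1) (i : ℕ) (u : ℝ) :
    tail q Γ z η T i u ≤ 1 := by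
  induction i generalizing u with
  | zero => rw [tail]; split <;> norm_num
  | succ i ih =>
    rw [← hq1]
    exact Finset.sum_le_sum fun x _ => mul_le_of_le_one_right (hq x) (ih _)

theorem tail_mono (hq : ∀ x, 0 ≤ q x) (i : ℕ) : Monotone (tail q Γ z η T i) := by
  induction i with
  | zero =>
    intro u u' h
    simp only [tail]
    split_ifs <;> linarith
  | succ i ih =>
    intro u u' h
    exact Finset.sum_le_sum fun x _ => mul_le_mul_of_nonneg_left (ih (by linarith)) (hq x)

/-- Chebyshev's inequality. -/
theorem tail_le (hq : ∀ x, 0 ≤ q x) (hq1 : ∑ x, q x = 1) (hΓ : ∀ x, 0 ≤ Γ x)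
    (hΓ1 : ∀ x, Γ x ≤ 1) (hz : z ^ 2 = 1) {T₀ : ℝ} (hT : T₀ < T) (i : ℕ) (u : ℝ) :
    tail q Γ z η T i u ≤
      ((u + i * (z * ∑ x, q x * Γ x + η) - T₀) ^ 2 + i / 4) / (T - T₀) ^ 2 := by
  have hD : 0 < T - T₀ := sub_pos.2 hT
  set μ := ∑ x, q x * Γ x with hμ
  induction i generalizing u with
  | zero =>
    rw [tail]
    split_ifs with h
    · rw [le_div_iff₀ (by positivity)]
      push_cast
      nlinarith
    · positivity
  | succ i ih =>
    -- Since `0 ≤ Γ ≤ 1`, the variance is at most `μ - μ² ≤ 1/4`.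
    have hvar : ∑ x, q x * Γ x ^ 2 ≤ μ :=
      Finset.sum_le_sum fun x _ =>
        mul_le_mul_of_nonneg_left (by nlinarith [hΓ x, hΓ1 x]) (hq x)
    have hsq : ∀ s : ℝ, ∑ x, q x * ((s + z * Γ x) ^ 2 + i / 4) ≤
        (s + z * μ) ^ 2 + (i + 1) / 4 := fun s => by
      have e : ∑ x, q x * ((s + z * Γ x) ^ 2 + i / 4) =
          (s ^ 2 + i / 4) * ∑ x, q x + 2 * s * z * ∑ x, q x * Γ x +
            z ^ 2 * ∑ x, q x * Γ x ^ 2 := by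
        rw [Finset.mul_sum, Finset.mul_sum, Finset.mul_sum, ← Finset.sum_add_distrib,
          ← Finset.sum_add_distrib]
        exact Finset.sum_congr rfl fun x _ => by ring
      rw [e, hq1, ← hμ, hz]
      have : (s + z * μ) ^ 2 = s ^ 2 + 2 * s * z * μ + μ ^ 2 := by linear_combination μ ^ 2 * hz
      nlinarith [sq_nonneg (μ - 1 / 2)]
    calc tail q Γ z η T (i + 1) u
        ≤ ∑ x, q x * (((u + z * Γ x + η + i * (z * μ + η) - T₀) ^ 2 + i / 4) / (T - T₀) ^ 2) :=
          Finset.sum_le_sum fun x _ => mul_le_mul_of_nonneg_left (ih _) (hq x)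
      _ = (∑ x, q x * ((u + η + i * (z * μ + η) - T₀ + z * Γ x) ^ 2 + i / 4)) /
            (T - T₀) ^ 2 := by
          rw [Finset.sum_div]
          exact Finset.sum_congr rfl fun x _ => by ring
      _ ≤ ((u + η + i * (z * μ + η) - T₀ + z * μ) ^ 2 + (i + 1) / 4) / (T - T₀) ^ 2 := by
          gcongr
          exact hsq _
      _ = _ := by
          push_cast
          ring

variable {S : Type v} {n : ℕ} [Fintype S] [Nonempty S]
  {OP OQ : QueryString S n → PMF (Fin n → S)} {h : ℝ}

/-- Up to failures of probability `δ`, the metered algorithm `x` computes a number within `η` of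
`Γ ω`, where `ω` is drawn with the weights `q`; the expected cost is `c`. -/
def Approximates (OP OQ : QueryString S n → PMF (Fin n → S)) (h : ℝ) (x : Metered S n ℝ)
    (q Γ : Ω → ℝ) (η c δ : ℝ) : Prop :=
  ∀ (F : ℝ → ℝ) (B : Ω → ℝ), (∀ ω, 0 ≤ B ω) → (∀ g ω, F g ≤ B ω + 1) →
    (∀ g ω, |g - Γ ω| ≤ η → F g ≤ B ω) →
    Metered.LossBound OP OQ h x F (h * c + δ + ∑ ω, q ω * B ω)

/-- `tail` is monotone in the partial sum, so an estimate within `η` can be replaced by the exact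
statistic shifted by `η` in the unfavourable direction. Failures and costs simply add up. -/
theorem Approximates.lossBound_forEach {x : Metered S n ℝ} {c δ : ℝ}
    (hx : Approximates OP OQ h x q Γ η c δ) (hq : ∀ x, 0 ≤ q x) (hq1 : ∑ x, q x = 1)
    (hh : 0 ≤ h) (hc : 0 ≤ c) (hδ : 0 ≤ δ) (hz : |z| = 1) {ι : Type w} (l : List ι) (u : ℝ) :
    Metered.LossBound OP OQ h (Metered.forEach (fun _ => x) l)
      (fun gs => if T ≤ u + z * gs.sum then 1 else 0)
      (l.length * (h * c + δ) + tail q Γ z η T l.length u) := by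
  induction l generalizing u with
  | nil => exact .pure (by simp [tail])
  | cons i l ih =>
    have hr : 0 ≤ l.length * (h * c + δ) := by positivity
    have h1 := hx (fun g => l.length * (h * c + δ) + tail q Γ z η T l.length (u + z * g))
      (fun ω => l.length * (h * c + δ) + tail q Γ z η T l.length (u + z * Γ ω + η))
      (fun ω => add_nonneg hr (tail_nonneg hq _ _))
      (fun g ω => by
        have := tail_le_one (Γ := Γ) (z := z) (η := η) (T := T) hq hq1 l.length (u + z * g)
        have := tail_nonneg (Γ := Γ) (z := z) (η := η) (T := T) hq l.length (u + z * Γ ω + η)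
        linarith)
      (fun g ω hg => by
        refine add_le_add le_rfl (tail_mono hq _ ?_)
        have : z * (g - Γ ω) ≤ η := by
          refine (le_abs_self _).trans ?_
          rwa [abs_mul, hz, one_mul]
        linarith)
    refine (Metered.LossBound.forEach_cons h1 fun g => (ih (u + z * g)).mono (fun gs => ?_)
      le_rfl).mono (fun _ => le_rfl) (le_of_eq ?_)
    · rw [List.sum_cons, mul_add, add_assoc]
    · simp only [mul_add, Finset.sum_add_distrib, ← Finset.sum_mul, hq1, List.length_cons, tail]
      push_cast
      ring

end Tail

/-! ### A round of the tester -/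

section Round

variable {S : Type u} {n : ℕ} [Fintype S] [Nonempty S] [DecidableEq S]
  {P Q : PMF (Fin n → S)} {OP OQ : QueryString S n → PMF (Fin n → S)} {h : ℝ}

/-- The value that a round of the tester estimates. -/
noncomputable def statistic (OP : QueryString S n → PMF (Fin n → S)) (Q : PMF (Fin n → S))
    (θ : ℝ) (σ : Fin n → S) : ℝ :=
  max 0 (1 - (∏ j, tamed θ OP σ j) / (Q σ).toReal)

/-- A bound for the expected number of calls in a round of the tester. -/
noncomputable def roundCost (card n : ℕ) (γ : ℝ) : ℝ :=
  1 + numReps γ * (n * (⌈4 * (n : ℝ) / (γ / 8) ^ 2⌉₊ / (γ / (2 * card * n)))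
    + ⌈4 * (n : ℝ) / (γ / 8) ^ 2⌉₊ * n * card)

theorem approximates_testRound (hQ : IsSubcondOracle Q OQ) (hn : 1 ≤ n) {γ : ℝ} (hγ : 0 < γ)
    (hγ' : γ ≤ 1 / 2) (hh : 0 ≤ h) :
    Approximates OP OQ h (testRound γ) (fun σ => (Q σ).toReal)
      (statistic OP Q (γ / (2 * Fintype.card S * n))) (32 / 15 * (γ / 8))
      (roundCost (Fintype.card S) n γ) (2 * (17 / 18) ^ numReps γ) := by
  intro F B hB hF hF'
  have hn' : (1 : ℝ) ≤ n := by exact_mod_cast hn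
  have hS : (0 : ℝ) < Fintype.card S := by exact_mod_cast Fintype.card_pos
  set θ := γ / (2 * Fintype.card S * n) with hθdef
  have hθ : 0 < θ := by positivity
  have hθ' : Fintype.card S * θ ≤ 1 := by
    have : Fintype.card S * θ = γ / (2 * n) := by
      rw [hθdef]
      field_simp
    rw [this, div_le_one (by positivity)]
    linarith
  set k : ℝ := (⌈4 * (n : ℝ) / (γ / 8) ^ 2⌉₊ : ℝ) with hk
  have hk0 : 0 ≤ k := Nat.cast_nonneg _
  have hcP : ∀ σ, ∑ j, k / tamed θ OP σ j ≤ n * (k / θ) := fun σ => by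
    refine (Finset.sum_le_sum fun j _ =>
      div_le_div_of_nonneg_left hk0 hθ (le_tamed hθ' σ j)).trans_eq ?_
    simp
  refine Metered.LossBound.callQ_bind
    (G := fun σ => h * (numReps γ * (n * (k / θ) + ∑ j, k / marginal OQ σ j (σ j))) +
      (B σ + 2 * (17 / 18) ^ numReps γ)) (fun σ => ?_) (fun σ hσ => ?_) ?_
  · have : 0 ≤ ∑ j, k / marginal OQ σ j (σ j) :=
      Finset.sum_nonneg fun j _ => div_nonneg hk0 (marginal_nonneg _ _ _)
    have := hB σ
    positivity
  · have hprod : 0 < ∏ j, marginal OQ σ j (σ j) := by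
      rw [← hQ.toReal_apply]
      rw [hQ.apply_none] at hσ
      exact ENNReal.toReal_pos hσ (Q.apply_ne_top σ)
    have hq : ∀ j, 0 < marginal OQ σ j (σ j) := fun j =>
      (marginal_nonneg σ j _).lt_of_ne' fun h0 =>
        hprod.ne' (Finset.prod_eq_zero (Finset.mem_univ j) h0)
    refine (lossBound_round (OP := OP) (OQ := OQ) (h := h) (σ := σ) (askP := askTamed θ)
      (askQ := askMarginal .Q) (hitsWith_askTamed hθ.le hθ' σ)
      (fun j => hitsWith_askMarginal_Q σ j (σ j)) (fun j => hθ.trans_le (le_tamed hθ' σ j))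
      (tamed_le_one hθ.le hθ' σ) hq (fun j => marginal_le_one σ j _) hh hn (ε := γ / 8)
      (by positivity) (by linarith) (numReps γ) (hB σ) (fun g => hF g σ) fun g hg => ?_).mono
      (fun _ => le_rfl) ?_
    · rw [← hQ.toReal_apply] at hg
      exact hF' g σ hg
    · gcongr
      exact hcP σ
  · have hcost := hQ.sum_mul_sum_div_le hk0
    have e : ∑ σ, (OQ (fun _ => none) σ).toReal *
        (h * (numReps γ * (n * (k / θ) + ∑ j, k / marginal OQ σ j (σ j))) +
          (B σ + 2 * (17 / 18) ^ numReps γ)) =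
        (h * (numReps γ * (n * (k / θ))) + 2 * (17 / 18) ^ numReps γ) * ∑ σ, (Q σ).toReal
        + h * numReps γ * ∑ σ, (Q σ).toReal * ∑ j, k / marginal OQ σ j (σ j)
        + ∑ σ, (Q σ).toReal * B σ := by
      rw [Finset.mul_sum, Finset.mul_sum, ← Finset.sum_add_distrib, ← Finset.sum_add_distrib]
      refine Finset.sum_congr rfl fun σ _ => ?_
      rw [hQ.apply_none]
      ring
    rw [e, Prog.sum_toReal_eq_one, roundCost, ← hk, ← hθdef]
    have := mul_le_mul_of_nonneg_left hcost (by positivity : 0 ≤ h * numReps γ)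
    linarith

end Round

/-! ### Parameters -/

section Parameters

/-- `16 log 20 ≥ 64 log 2 > 44`. -/
theorem le_numSamples_mul_sq {γ : ℝ} (hγ : 0 < γ) : 44 ≤ numSamples γ * γ ^ 2 := by
  have h1 : 2 ^ 4 * Real.log 20 / γ ^ 2 ≤ numSamples γ := Nat.le_ceil _
  rw [div_le_iff₀ (by positivity)] at h1
  have h2 : 4 * Real.log 2 ≤ Real.log 20 := by
    rw [← Real.log_rpow (by norm_num) (4 : ℝ)]
    exact Real.log_le_log (by positivity) (by norm_num)
  have := Real.log_two_gt_d9
  linarith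

theorem numSamples_pos {γ : ℝ} (hγ : 0 < γ) : 0 < numSamples γ := by
  by_contra! h
  have := le_numSamples_mul_sq hγ
  rw [Nat.le_zero.1 h] at this
  norm_num at this

theorem le_numReps (γ : ℝ) : 48 * Real.log (10 * numSamples γ) ≤ numReps γ := Nat.le_ceil _

theorem numReps_pos {γ : ℝ} (hγ : 0 < γ) : 0 < numReps γ := by
  have h1 : (1 : ℝ) ≤ numSamples γ := by exact_mod_cast numSamples_pos hγ
  refine Nat.ceil_pos.2 (mul_pos (by norm_num) (Real.log_pos ?_))
  linarith

/-- `(17/18)^t ≤ e^(-t/18)` and `48/18 ≥ 2`, so the failure probability of a median is at most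
`(10m)⁻²`, small enough for a union bound over `2m` medians. -/
theorem numSamples_mul_failure_le {γ : ℝ} (hγ : 0 < γ) :
    numSamples γ * (2 * (17 / 18 : ℝ) ^ numReps γ) ≤ 1 / 50 := by
  have hm : (1 : ℝ) ≤ numSamples γ := by exact_mod_cast numSamples_pos hγ
  have h1 : (17 / 18 : ℝ) ^ numReps γ ≤ ((10 * numSamples γ) ^ 2 : ℝ)⁻¹ := by
    calc (17 / 18 : ℝ) ^ numReps γ ≤ Real.exp (-(1 / 18)) ^ numReps γ := by
          gcongr
          have := Real.add_one_le_exp (-(1 / 18))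
          linarith
      _ = Real.exp (numReps γ * -(1 / 18)) := (Real.exp_nat_mul _ _).symm
      _ ≤ Real.exp (-(2 * Real.log (10 * numSamples γ))) := by
          rw [Real.exp_le_exp]
          have := le_numReps γ
          have := Real.log_nonneg (by linarith : (1 : ℝ) ≤ 10 * numSamples γ)
          linarith
      _ = _ := by
          rw [Real.exp_neg, two_mul, Real.exp_add, Real.exp_log (by positivity), sq]
  calc numSamples γ * (2 * (17 / 18 : ℝ) ^ numReps γ)
      ≤ numSamples γ * (2 * ((10 * numSamples γ) ^ 2 : ℝ)⁻¹) := by gcongr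
    _ = 1 / 50 * (numSamples γ : ℝ)⁻¹ := by
        field_simp
        norm_num
    _ ≤ 1 / 50 := mul_le_of_le_one_right (by norm_num) (inv_le_one_of_one_le₀ hm)

theorem ten_mul_numSamples_mul_roundCost_le {card n : ℕ} (hc : 1 ≤ card) (hn : 1 ≤ n) {γ : ℝ}
    (hγ : 0 < γ) (hγ' : γ ≤ 1 / 2) :
    10 * (numSamples γ * roundCost card n γ) ≤ gridBudget card n γ := by
  have hn' : (1 : ℝ) ≤ n := by exact_mod_cast hn
  have hc' : (1 : ℝ) ≤ card := by exact_mod_cast hc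
  have ht : (1 : ℝ) ≤ numReps γ := by exact_mod_cast numReps_pos hγ
  have hk : (⌈4 * (n : ℝ) / (γ / 8) ^ 2⌉₊ : ℝ) ≤ 256 * n / γ ^ 2 + 1 := by
    refine (Nat.ceil_lt_add_one (by positivity)).le.trans (le_of_eq ?_)
    field_simp
    ring
  rw [roundCost, gridBudget]
  set k : ℝ := (⌈4 * (n : ℝ) / (γ / 8) ^ 2⌉₊ : ℝ)
  set t : ℝ := (numReps γ : ℝ)
  set m : ℝ := (numSamples γ : ℝ)
  set c : ℝ := (card : ℝ)
  set N : ℝ := (n : ℝ)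
  have h1 : N * (k / (γ / (2 * c * N))) ≤ c * (512 * (N ^ 3 / γ ^ 3) + N ^ 2 / γ ^ 2) := by
    calc N * (k / (γ / (2 * c * N))) ≤ N * ((256 * N / γ ^ 2 + 1) / (γ / (2 * c * N))) := by
          gcongr
      _ = c * (512 * (N ^ 3 / γ ^ 3) + N ^ 2 / γ ^ 2 * (2 * γ)) := by
          field_simp
          ring
      _ ≤ c * (512 * (N ^ 3 / γ ^ 3) + N ^ 2 / γ ^ 2) := by
          gcongr
          exact mul_le_of_le_one_right (by positivity) (by linarith)
  have hNγ : 1 ≤ N / γ := by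
    rw [one_le_div hγ]
    linarith
  have hNγ2 : N ≤ N ^ 2 / γ ^ 2 := by
    rw [le_div_iff₀ (by positivity), sq N]
    have : γ ^ 2 ≤ 1 := by nlinarith
    nlinarith [mul_le_mul_of_nonneg_left this (by positivity : 0 ≤ N)]
  have h2 : k * N * c ≤ c * (257 * (N ^ 2 / γ ^ 2)) := by
    calc k * N * c ≤ (256 * N / γ ^ 2 + 1) * N * c := by gcongr
      _ = c * (256 * (N ^ 2 / γ ^ 2) + N) := by ring
      _ ≤ c * (257 * (N ^ 2 / γ ^ 2)) := by
          gcongr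
          linarith
  -- Absorbs the single call that draws `σ` into the term in `N² / γ²`.
  have h3 : 1 ≤ t * (c * (N ^ 2 / γ ^ 2)) :=
    one_le_mul_of_one_le_of_one_le ht (one_le_mul_of_one_le_of_one_le hc' (hn'.trans hNγ2))
  have hpos : 0 ≤ N ^ 3 / γ ^ 3 := by positivity
  have hpos2 : 0 ≤ N ^ 2 / γ ^ 2 := by positivity
  have hm : 0 ≤ m := Nat.cast_nonneg _
  calc 10 * (m * (1 + t * (N * (k / (γ / (2 * c * N))) + k * N * c)))
      ≤ 10 * (m * (t * (c * (N ^ 2 / γ ^ 2)) + t * (c * (512 * (N ^ 3 / γ ^ 3) + N ^ 2 / γ ^ 2)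
          + c * (257 * (N ^ 2 / γ ^ 2))))) := by gcongr
    _ = 10 * (m * (t * (c * (512 * (N ^ 3 / γ ^ 3) + 259 * (N ^ 2 / γ ^ 2))))) := by ring
    _ ≤ 10 * (m * (t * (c * (1024 * (N ^ 3 / γ ^ 3) + 512 * (N ^ 2 / γ ^ 2))))) := by
        gcongr <;> norm_num
    _ = _ := by ring

end Parameters

/-! ### Correctness -/

theorem card_mul_tamingParameter
    {S : Type u} {n : ℕ} [Fintype S] [Nonempty S] {γ : ℝ} (hn : 1 ≤ n) :
    (n : ℝ) * (Fintype.card S * (γ / (2 * Fintype.card S * n))) = γ / 2 := by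
  have hn' : (0 : ℝ) < n := by exact_mod_cast hn
  have hS : (0 : ℝ) < Fintype.card S := by exact_mod_cast Fintype.card_pos
  field_simp

theorem card_mul_tamingParameter_le_one
    {S : Type u} {n : ℕ} [Fintype S] [Nonempty S] {γ : ℝ} (hn : 1 ≤ n) (hγ : 0 < γ)
    (hγ' : γ ≤ 1 / 2) :
    Fintype.card S * (γ / (2 * Fintype.card S * n)) ≤ 1 := by
  have h := card_mul_tamingParameter (S := S) (γ := γ) hn
  have hn' : (1 : ℝ) ≤ n := by exact_mod_cast hn
  have : 0 ≤ Fintype.card S * (γ / (2 * Fintype.card S * n)) := by positivity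
  nlinarith

section Correctness

variable {S : Type u} {n : ℕ} [Fintype S] [DecidableEq S]
  {P Q : PMF (Fin n → S)} {OP OQ : QueryString S n → PMF (Fin n → S)} {ε₁ ε₂ γ : ℝ}

/-- The bad outcomes of the rounds: the budget was exceeded, or `z` times the sum of the statistics
is at least `T`. -/
noncomputable def badOutcome (z T : ℝ) : Option (List ℝ × ℕ) → ℝ
  | none => 1
  | some (gs, _) => if T ≤ z * gs.sum then 1 else 0

theorem statistic_nonneg (θ : ℝ) (σ : Fin n → S) : 0 ≤ statistic OP Q θ σ := le_max_left _ _

theorem statistic_le_one {θ : ℝ} (hθ : 0 ≤ θ) (hθ' : Fintype.card S * θ ≤ 1)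
    (σ : Fin n → S) : statistic OP Q θ σ ≤ 1 := by
  have : 0 ≤ (∏ j, tamed θ OP σ j) / (Q σ).toReal :=
    div_nonneg (Finset.prod_nonneg fun j _ => hθ.trans (le_tamed hθ' σ j)) ENNReal.toReal_nonneg
  exact max_le zero_le_one (by linarith)

variable [Nonempty S]

/-- Taking `h = (b + 1)⁻¹` makes the loss dominate the indicator of a bad outcome. The sign `z = ±1`
treats both tails at once. -/
theorem expect_badOutcome_le (hQ : IsSubcondOracle Q OQ) (hn : 1 ≤ n) (hγ : 0 < γ)
    (hγ' : γ ≤ 1 / 2) {z T : ℝ} (hz : |z| = 1)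
    (hT : numSamples γ * (z * (∑ σ, (Q σ).toReal *
      statistic OP Q (γ / (2 * Fintype.card S * n)) σ) + γ / 2) ≤ T) :
    (Metered.forEach (fun _ : ℕ => (testRound γ : Metered S n ℝ)) (List.range (numSamples γ))
      ⌊gridBudget (Fintype.card S) n γ⌋₊).expect OP OQ (badOutcome z T) ≤ 2 / 5 := by
  set b := ⌊gridBudget (Fintype.card S) n γ⌋₊ with hb
  set θ := γ / (2 * Fintype.card S * n) with hθdef
  set μ := ∑ σ, (Q σ).toReal * statistic OP Q θ σ with hμ
  have hm : (0 : ℝ) < numSamples γ := by exact_mod_cast numSamples_pos hγ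
  have hθ' : Fintype.card S * θ ≤ 1 := card_mul_tamingParameter_le_one hn hγ hγ'
  have hθ : 0 ≤ θ := by positivity
  have hcost0 : 0 ≤ roundCost (Fintype.card S) n γ := by
    rw [roundCost]
    positivity
  have hb0 : (0 : ℝ) < b + 1 := by positivity
  have hbound := (approximates_testRound (OP := OP) hQ hn hγ hγ'
    (inv_nonneg.2 hb0.le)).lossBound_forEach (z := z) (T := T) (fun _ => ENNReal.toReal_nonneg)
    (Prog.sum_toReal_eq_one Q) (inv_nonneg.2 hb0.le) hcost0 (by positivity) hz
    (List.range (numSamples γ)) 0 b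
  have hfrugal := Metered.Frugal.forEach
    (fun _ : ℕ => (frugal_testRound γ : (testRound γ : Metered S n ℝ).Frugal))
    (List.range (numSamples γ)) b
  refine (hfrugal.expect_mono fun r q' hq' hr => ?_).trans (hbound.trans ?_)
  · rcases r with _ | ⟨gs, b'⟩
    · simp only [badOutcome, Metered.loss]
      rw [mul_inv_cancel₀ hb0.ne']
    · simp only [badOutcome, Metered.loss, zero_add]
      have h1 : (b' : ℝ) ≤ b := by exact_mod_cast (hr gs b' rfl).trans hq'
      exact le_add_of_nonneg_left (mul_nonneg (sub_nonneg.2 h1) (inv_nonneg.2 hb0.le))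
  · rw [List.length_range]
    have hz2 : z ^ 2 = 1 := by rw [← sq_abs, hz, one_pow]
    -- The hypothesis leaves a margin `γ/2` per round; estimation uses `(32/15)(γ/8) = 4γ/15`, and
    -- `7γ/30` remains for Chebyshev.
    have hgap : numSamples γ * (7 / 30 * γ) ≤
        T - numSamples γ * (z * μ + 32 / 15 * (γ / 8)) := by linarith
    have hpos : 0 < numSamples γ * (7 / 30 * γ) := by positivity
    have htail := tail_le (η := 32 / 15 * (γ / 8)) (fun _ => ENNReal.toReal_nonneg)
      (Prog.sum_toReal_eq_one Q) (statistic_nonneg (OP := OP) (Q := Q) θ)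
      (statistic_le_one hθ hθ') hz2 (T := T)
      (T₀ := numSamples γ * (z * μ + 32 / 15 * (γ / 8))) (by linarith) (numSamples γ) 0
    rw [← hμ, zero_add, sub_self, zero_pow two_ne_zero, zero_add] at htail
    have htail' : (numSamples γ / 4 : ℝ) /
        (T - numSamples γ * (z * μ + 32 / 15 * (γ / 8))) ^ 2 ≤ 11 / 100 := by
      calc (numSamples γ / 4 : ℝ) / (T - numSamples γ * (z * μ + 32 / 15 * (γ / 8))) ^ 2
          ≤ (numSamples γ / 4 : ℝ) / (numSamples γ * (7 / 30 * γ)) ^ 2 := by gcongr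
        _ = 225 / 49 / (numSamples γ * γ ^ 2) := by
            field_simp
            norm_num
        _ ≤ 225 / 49 / 44 := by
            gcongr
            exact le_numSamples_mul_sq hγ
        _ ≤ 11 / 100 := by norm_num
    have hbudget : numSamples γ * ((b + 1 : ℝ)⁻¹ * roundCost (Fintype.card S) n γ) ≤ 1 / 10 := by
      have h1 := ten_mul_numSamples_mul_roundCost_le
        (Nat.succ_le_of_lt (Fintype.card_pos (α := S))) hn hγ hγ'
      have h2 := (Nat.lt_floor_add_one (gridBudget (Fintype.card S) n γ)).le
      rw [← hb] at h2
      rw [mul_left_comm, inv_mul_le_iff₀ hb0]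
      linarith
    have hfail := numSamples_mul_failure_le hγ
    rw [mul_add]
    linarith

theorem abs_sum_statistic_sub_tvDist_le (hP : IsSubcondOracle P OP) (hn : 1 ≤ n) (hγ : 0 < γ)
    (hγ' : γ ≤ 1 / 2) :
    |∑ σ, (Q σ).toReal * statistic OP Q (γ / (2 * Fintype.card S * n)) σ - tvDist P Q| ≤
      γ / 2 := by
  have hθ' := card_mul_tamingParameter_le_one (S := S) hn hγ hγ'
  have hθ : 0 ≤ γ / (2 * Fintype.card S * n) := by positivity
  refine abs_sum_max_sub_tvDist_le P Q _ (fun σ => Finset.prod_nonneg fun j _ =>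
    hθ.trans (le_tamed hθ' σ j)) (by positivity) (fun σ => ?_) (sum_prod_tamed_le_one hθ hθ')
  have h := hP.mul_le_prod_tamed hθ hθ' σ
  rwa [card_mul_tamingParameter hn] at h

instance : DecidableEq Verdict := fun a b => by
  cases a <;> cases b
  · exact isTrue rfl
  · exact isFalse (by simp)
  · exact isFalse (by simp)
  · exact isTrue rfl

/-- The tester returns `v` if this is the verdict in all outcomes that are not bad. -/
theorem three_fifths_le_eval (hQ : IsSubcondOracle Q OQ) (hn : 1 ≤ n)
    (hγ : 0 < gap ε₁ ε₂) (hγ' : gap ε₁ ε₂ ≤ 1 / 2) {z T : ℝ} (hz : |z| = 1) (v : Verdict)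
    (hT : numSamples (gap ε₁ ε₂) * (z * (∑ σ, (Q σ).toReal *
      statistic OP Q (gap ε₁ ε₂ / (2 * Fintype.card S * n)) σ) + gap ε₁ ε₂ / 2) ≤ T)
    (hv : ∀ s : ℝ, z * s < T →
      (if s / numSamples (gap ε₁ ε₂) ≤ (ε₁ + ε₂) / 2 then Verdict.accept else Verdict.reject) =
        v) :
    3 / 5 ≤ (subVsSub S n ε₁ ε₂).eval OP OQ v := by
  have hbad := expect_badOutcome_le (OP := OP) hQ hn hγ hγ' hz hT
  have h35 : (3 / 5 : ℝ≥0∞) = ENNReal.ofReal (3 / 5) := by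
    rw [ENNReal.ofReal_div_of_pos (by norm_num)]
    norm_num
  rw [Prog.eval_apply, h35, subVsSub, Prog.expect_bind]
  refine ENNReal.ofReal_le_ofReal (le_trans ?_ (Prog.expect_mono
    (F := fun r => 1 - badOutcome z T r) (fun r => ?_) _))
  · rw [Prog.expect_const_sub]
    linarith
  · rcases r with _ | ⟨gs, b'⟩
    · simp only [badOutcome, sub_self]
      exact Prog.expect_nonneg (fun a => by split <;> simp) _
    · rcases lt_or_ge (z * gs.sum) T with h | h
      · have h1 := hv gs.sum h
        have h2 : ∀ w : Verdict, w = v → badOutcome z T (some (gs, b')) = 0 := fun _ _ =>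
          if_neg (not_le.2 h)
        rw [h2 v rfl]
        dsimp only
        split_ifs at h1 ⊢ <;> simp [Prog.expect, h1]
      · have h2 : badOutcome z T (some (gs, b')) = 1 := if_pos h
        rw [h2, sub_self]
        exact Prog.expect_nonneg (fun a => by split <;> simp) _

theorem three_fifths_le_eval_accept (hP : IsSubcondOracle P OP) (hQ : IsSubcondOracle Q OQ)
    (hn : 1 ≤ n) (h₁ : 0 ≤ ε₁) (h₁₂ : ε₁ < ε₂) (h₂ : ε₂ ≤ 1) (h : tvDist P Q < ε₁) :
    3 / 5 ≤ (subVsSub S n ε₁ ε₂).eval OP OQ .accept := by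
  have hγ : 0 < gap ε₁ ε₂ := by rw [gap]; linarith
  have hγ' : gap ε₁ ε₂ ≤ 1 / 2 := by rw [gap]; linarith
  have hm : (0 : ℝ) < numSamples (gap ε₁ ε₂) := by exact_mod_cast numSamples_pos hγ
  have hμ := (abs_le.1 (abs_sum_statistic_sub_tvDist_le (Q := Q) hP hn hγ hγ')).2
  refine three_fifths_le_eval hQ hn hγ hγ' (z := 1)
    (T := numSamples (gap ε₁ ε₂) * ((ε₁ + ε₂) / 2)) abs_one _ ?_ fun s hs => if_pos ?_
  -- The threshold is `ε₁ + γ`: one `γ/2` is spent on taming, the other is the margin.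
  · refine mul_le_mul_of_nonneg_left ?_ hm.le
    have : gap ε₁ ε₂ = (ε₂ - ε₁) / 2 := rfl
    linarith
  · rw [div_le_iff₀ hm]
    linarith

theorem three_fifths_le_eval_reject (hP : IsSubcondOracle P OP) (hQ : IsSubcondOracle Q OQ)
    (hn : 1 ≤ n) (h₁ : 0 ≤ ε₁) (h₁₂ : ε₁ < ε₂) (h₂ : ε₂ ≤ 1) (h : ε₂ < tvDist P Q) :
    3 / 5 ≤ (subVsSub S n ε₁ ε₂).eval OP OQ .reject := by
  have hγ : 0 < gap ε₁ ε₂ := by rw [gap]; linarith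
  have hγ' : gap ε₁ ε₂ ≤ 1 / 2 := by rw [gap]; linarith
  have hm : (0 : ℝ) < numSamples (gap ε₁ ε₂) := by exact_mod_cast numSamples_pos hγ
  have hμ := (abs_le.1 (abs_sum_statistic_sub_tvDist_le (Q := Q) hP hn hγ hγ')).1
  refine three_fifths_le_eval hQ hn hγ hγ' (z := -1)
    (T := numSamples (gap ε₁ ε₂) * -((ε₁ + ε₂) / 2)) (by simp) _ ?_ fun s hs =>
    if_neg (not_le.2 ?_)
  · refine mul_le_mul_of_nonneg_left ?_ hm.le
    have : gap ε₁ ε₂ = (ε₂ - ε₁) / 2 := rfl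
    linarith
  · rw [lt_div_iff₀ hm]
    linarith

end Correctness

/-! ### The size of the budget -/

theorem numSamples_half_le {e : ℝ} (he : 0 < e) (he' : e ≤ 1) :
    (numSamples (e / 2) : ℝ) ≤ 225 / e ^ 2 := by
  have h1 : Real.log 20 ≤ 7 / 2 := by
    calc Real.log 20 ≤ Real.log (2 ^ (5 : ℝ)) := Real.log_le_log (by norm_num) (by norm_num)
      _ = 5 * Real.log 2 := Real.log_rpow (by norm_num) _
      _ ≤ 7 / 2 := by
          have := Real.log_two_lt_d9
          linarith
  have h2 : 1 ≤ 1 / e ^ 2 := by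
    rw [one_le_div (by positivity)]
    exact pow_le_one₀ he.le he'
  calc (numSamples (e / 2) : ℝ) ≤ 2 ^ 4 * Real.log 20 / (e / 2) ^ 2 + 1 :=
        (Nat.ceil_lt_add_one (by have := Real.log_nonneg (by norm_num : (1 : ℝ) ≤ 20)
                                 positivity)).le
    _ = 64 * Real.log 20 * (1 / e ^ 2) + 1 := by
        field_simp
        ring
    _ ≤ 64 * (7 / 2) * (1 / e ^ 2) + 1 * (1 / e ^ 2) := by
        gcongr
        linarith
    _ = 225 / e ^ 2 := by ring

/-- `10 m ≤ 2250/e² ≤ 2^12 X`, so the logarithm is at most `12 + log X`; the constant is `48 · 12 +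
1`. -/
theorem numReps_half_le {e X : ℝ} (he : 0 < e) (he' : e ≤ 1) (hX : 1 / e ^ 5 ≤ X) :
    (numReps (e / 2) : ℝ) ≤ 577 * (1 + Real.log X) := by
  have hm : (1 : ℝ) ≤ numSamples (e / 2) := by exact_mod_cast numSamples_pos (half_pos he)
  have hX0 : 0 < X := lt_of_lt_of_le (by positivity) hX
  have hX1 : 1 ≤ X := by
    refine le_trans ?_ hX
    rw [one_le_div (by positivity)]
    exact pow_le_one₀ he.le he'
  have hL := Real.log_nonneg hX1
  have hle : (10 * numSamples (e / 2) : ℝ) ≤ 2 ^ (12 : ℝ) * X := by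
    calc (10 * numSamples (e / 2) : ℝ) ≤ 10 * (225 / e ^ 2) := by
          gcongr
          exact numSamples_half_le he he'
      _ = 2250 * (1 / e ^ 2) := by ring
      _ ≤ 2 ^ (12 : ℝ) * (1 / e ^ 5) := by
          gcongr ?_ * (1 / ?_)
          · norm_num
          · exact pow_le_pow_of_le_one he.le he' (by norm_num)
      _ ≤ 2 ^ (12 : ℝ) * X := by gcongr
  have hlog : Real.log (10 * numSamples (e / 2)) ≤ 12 + Real.log X := by
    refine (Real.log_le_log (by positivity) hle).trans ?_
    rw [Real.log_mul (by positivity) hX0.ne', Real.log_rpow (by norm_num)]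
    have := Real.log_two_lt_d9
    linarith
  calc (numReps (e / 2) : ℝ) ≤ 48 * Real.log (10 * numSamples (e / 2)) + 1 :=
        (Nat.ceil_lt_add_one (mul_nonneg (by norm_num) (Real.log_nonneg (by linarith)))).le
    _ ≤ _ := by linarith

theorem gridBudget_half_le {card n : ℕ} (hc : 1 ≤ card) (hn : 1 ≤ n) {e : ℝ} (he : 0 < e)
    (he' : e ≤ 1) :
    gridBudget card n (e / 2) ≤ 102400 * 225 * 577 * ((n : ℝ) ^ 3 * card / e ^ 5) *
      (1 + Real.log ((n : ℝ) ^ 3 * card / e ^ 5)) ^ 1 := by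
  have hn' : (1 : ℝ) ≤ n := by exact_mod_cast hn
  have hc' : (1 : ℝ) ≤ card := by exact_mod_cast hc
  have hm := numSamples_half_le he he'
  have ht := numReps_half_le he he' (X := (n : ℝ) ^ 3 * card / e ^ 5) (by
    gcongr
    exact one_le_mul_of_one_le_of_one_le (one_le_pow₀ hn') hc')
  have h2 : (n : ℝ) ^ 2 / e ^ 2 ≤ (n : ℝ) ^ 3 / e ^ 3 := by
    gcongr ?_ / ?_
    · exact pow_le_pow_right₀ hn' (by norm_num)
    · exact pow_le_pow_of_le_one he.le he' (by norm_num)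
  rw [gridBudget, pow_one]
  set m : ℝ := (numSamples (e / 2) : ℝ)
  set t : ℝ := (numReps (e / 2) : ℝ)
  have ht0 : 0 ≤ t := Nat.cast_nonneg _
  have hm0 : 0 ≤ m := Nat.cast_nonneg _
  calc 10 * (2 ^ 10 * (n : ℝ) ^ 3 * m * t / (e / 2) ^ 3
        + 2 ^ 9 * (n : ℝ) ^ 2 * m * t / (e / 2) ^ 2) * card
      = 10 * (m * t * (8192 * ((n : ℝ) ^ 3 / e ^ 3) + 2048 * ((n : ℝ) ^ 2 / e ^ 2))) * card := by
        field_simp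
        ring
    _ ≤ 10 * (m * t * (8192 * ((n : ℝ) ^ 3 / e ^ 3) + 2048 * ((n : ℝ) ^ 3 / e ^ 3))) * card := by
        gcongr
    _ = 102400 * (m * t) * ((n : ℝ) ^ 3 / e ^ 3) * card := by ring
    _ ≤ 102400 * (225 / e ^ 2 * (577 * (1 + Real.log ((n : ℝ) ^ 3 * card / e ^ 5))))
          * ((n : ℝ) ^ 3 / e ^ 3) * card := by gcongr
    _ = _ := by
        field_simp

end HypergridTest

theorem mainTheorem2 :
    ∃ (C : ℝ) (a : ℕ), ∀ (S : Type*) [Fintype S] [DecidableEq S] [Nonempty S] (n : ℕ) (ε₁ ε₂ : ℝ),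
      1 ≤ n → 0 ≤ ε₁ → ε₁ < ε₂ → ε₂ ≤ 1 →
      (∃ q : ℕ, (HypergridTest.subVsSub S n ε₁ ε₂).QueriesAtMost q ∧
        (q : ℝ) ≤ C * ((n : ℝ) ^ 3 * Fintype.card S / (ε₂ - ε₁) ^ 5) *
          (1 + Real.log ((n : ℝ) ^ 3 * Fintype.card S / (ε₂ - ε₁) ^ 5)) ^ a) ∧
      ∀ (P Q : PMF (Fin n → S))
        (OP OQ : HypergridTest.QueryString S n → PMF (Fin n → S)),
        HypergridTest.IsSubcondOracle P OP → HypergridTest.IsSubcondOracle Q OQ →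
        (HypergridTest.tvDist P Q < ε₁ →
          3 / 5 ≤ (HypergridTest.subVsSub S n ε₁ ε₂).eval OP OQ .accept) ∧
        (ε₂ < HypergridTest.tvDist P Q →
          3 / 5 ≤ (HypergridTest.subVsSub S n ε₁ ε₂).eval OP OQ .reject) := by
  refine ⟨102400 * 225 * 577, 1, fun S _ _ _ n ε₁ ε₂ hn h₁ h₁₂ h₂ =>
    ⟨⟨_, (HypergridTest.within_subVsSub ε₁ ε₂).queriesAtMost, ?_⟩, fun P Q OP OQ hP hQ =>
      ⟨HypergridTest.three_fifths_le_eval_accept hP hQ hn h₁ h₁₂ h₂,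
        HypergridTest.three_fifths_le_eval_reject hP hQ hn h₁ h₁₂ h₂⟩⟩⟩
  refine (Nat.floor_le ?_).trans (HypergridTest.gridBudget_half_le
    (Nat.succ_le_of_lt Fintype.card_pos) hn (sub_pos.2 h₁₂) (by linarith))
  have : 0 < HypergridTest.gap ε₁ ε₂ := half_pos (sub_pos.2 h₁₂)
  rw [HypergridTest.gridBudget]
  positivity
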